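/- For $n\ge 0$ let $\alpha_n=\sum_{k=0}^n\binom{n}{k}^2\binom{n+k}{n}^2$ be the Apéry numbers. Let $p$ be an odd prime and let $f_\alpha=\sum_{n\ge 0}\alpha_n t^n\in\mathbb F_p[[t]]$ be the reduction modulo $p$ of their generating series. Let $\mathbb F_p(t,f_\alpha)$ be the subfield of $\mathbb F_p((t))$ generated by $f_\alpha$ over $\mathbb F_p(t)$. The extension $\mathbb F_p(t,f_\alpha)/\mathbb F_p(t)$ is Galois, and $\sigma\mapsto\sigma(f_\alpha)/f_\alpha$ defines an injective group homomorphism $\mathrm{Gal}(\mathbb F_p(t,f_\alpha)/\mathbb F_p(t))\to\mathbb F_p^\times$. Moreover: - if $p\equiv 1,5,7,11\pmod{24}$, then the image of this homomorphism is the subgroup $S$ of squares in $\mathbb F_p^\times$; - if $p\equiv 13,17,19,23\pmod{24}$, then the image of this homomorphism is all of $\mathbb F_p^\times$. -/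

import Mathlib

open scoped LaurentSeries PowerSeries

/-- The Apéry numbers `∑ k ≤ n, (n choose k)² (n + k choose n)²`. -/
def aperyNumber (n : ℕ) : ℕ :=
  ∑ k ∈ Finset.range (n + 1), n.choose k ^ 2 * (n + k).choose n ^ 2

/-- The generating series of the Apéry numbers, reduced modulo `p`. -/
def aperySeries (p : ℕ) : (ZMod p)⟦X⟧ :=
  PowerSeries.mk fun n => (aperyNumber n : ZMod p)

/-- The field `𝔽_p((t))` of Laurent series as an extension of the field `𝔽_p(t)` of rational
functions, by expansion at `t = 0` (Mathlib's scoped instance, fixed here so that instance search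
does not use it elsewhere). -/
noncomputable instance ratFuncAlgebraLaurent (p : ℕ) [Fact p.Prime] :
    Algebra (RatFunc (ZMod p)) (ZMod p)⸨X⸩ :=
  RatFunc.liftAlgebra (ZMod p) (ZMod p)⸨X⸩

/-- The field `𝔽_p(t, f)` generated by the reduced Apéry series `f` over the field `𝔽_p(t)` of
rational functions, inside the field `𝔽_p((t))` of Laurent series. -/
noncomputable def aperyField (p : ℕ) [Fact p.Prime] :
    IntermediateField (RatFunc (ZMod p)) (ZMod p)⸨X⸩ :=
  IntermediateField.adjoin (RatFunc (ZMod p)) {((aperySeries p : (ZMod p)⟦X⟧) : (ZMod p)⸨X⸩)}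

/-- The reduced Apéry series as an element of `𝔽_p(t, f)`. -/
noncomputable def aperyGen (p : ℕ) [Fact p.Prime] : aperyField p :=
  ⟨((aperySeries p : (ZMod p)⟦X⟧) : (ZMod p)⸨X⸩),
    IntermediateField.subset_adjoin _ _ (Set.mem_singleton _)⟩

/-! Lucas' theorem gives α_{pm+r} ≡ α_m α_r for r < p, so f = A f^p with A the truncation of f below
degree p, and f^(p-1) = 1/A. As 𝔽_p contains the (p-1)-st roots of unity, Kummer theory makes the
extension Galois with an injective character into 𝔽_p^×. If the image has index e, then f^((p-1)/e)
is Galois invariant, hence rational, and A is an e-th power in 𝔽_p[t]. For p > 3 it remains to show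
e ≤ 2 and to decide when A is a square.

Both questions are settled on the double cover t = x(1-9x)/(1-x). There f(t) = (1-x) F(x)², with F
the generating series of `zagierNumber`: both sides solve the same quadratic differential equation
with constant term 1 (`aperyGenSeries_subst`). F has the Lucas property too, so its truncation H
satisfies H² = (1-x)^(p-1) A(t) (`zagierPoly_sq`). Modulo p, H solves the second-order equation of
F, so a repeated factor could only sit at the singular points 0, 1, 1/9, where H does not vanish.
Thus H is squarefree and e ≤ 2.

The cover is generated by a square root of D = t² - 34t + 1, which forces A = U² or A = D V². The
points x = 1 and x = ∞ both lie over t = ∞; comparing H(1) = 1 with the top coefficient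
(-3)^((p-1)/2) of H shows that A is a square exactly when -24 is a square modulo p, a condition on p
modulo 24. -/

/-- The sequence `∑ k ≤ n, (n choose k)² (2k choose k)`, the Apéry-like numbers of level six whose
generating series uniformises that of the Apéry numbers. -/
def zagierNumber (n : ℕ) : ℕ :=
  ∑ k ∈ Finset.range (n + 1), n.choose k ^ 2 * k.centralBinom

/-! ### Recurrences by creative telescoping. -/

theorem cast_choose_mul_succ (n k : ℕ) :
    (n.choose k : ℚ) * (n + 1) = ((n : ℚ) + 1 - k) * (n + 1).choose k := by
  rcases le_or_gt k (n + 1) with h | h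
  · have := Nat.choose_mul_succ_eq n k
    have h2 : ((n + 1 - k : ℕ) : ℚ) = (n : ℚ) + 1 - k := by
      rw [Nat.cast_sub h]; push_cast; ring
    rw [← h2, mul_comm _ (((n + 1).choose k : ℕ) : ℚ)]
    exact_mod_cast this
  · rw [Nat.choose_eq_zero_of_lt h, Nat.choose_eq_zero_of_lt (by omega)]; simp

theorem cast_choose_succ_mul (n k : ℕ) :
    (n.choose (k + 1) : ℚ) * (k + 1) = ((n : ℚ) - k) * n.choose k := by
  rcases le_or_gt k n with h | h
  · have := Nat.choose_succ_right_eq n k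
    have h2 : ((n - k : ℕ) : ℚ) = (n : ℚ) - k := by rw [Nat.cast_sub h]
    rw [← h2, mul_comm _ ((n.choose k : ℕ) : ℚ)]
    exact_mod_cast this
  · rw [Nat.choose_eq_zero_of_lt h, Nat.choose_eq_zero_of_lt (by omega)]; simp

theorem cast_centralBinom_succ (k : ℕ) :
    ((k + 1).centralBinom : ℚ) * (k + 1) = 2 * (2 * k + 1) * k.centralBinom := by
  have := Nat.succ_mul_centralBinom_succ k
  rw [mul_comm]
  exact_mod_cast this

theorem zagierNumber_eq_sum {n m : ℕ} (h : n < m) :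
    (zagierNumber n : ℚ) = ∑ k ∈ Finset.range m, (n.choose k : ℚ) ^ 2 * k.centralBinom := by
  rw [zagierNumber]
  push_cast
  refine Finset.sum_subset (by simpa using h) fun k _ hk => ?_
  rw [Nat.choose_eq_zero_of_lt (by simpa using hk)]; simp

/-- Zeilberger's method: the right side is the certificate, checked by induction on m. It vanishes
for m > n + 2, leaving the recurrence; the factor (n + 2)² clears its denominator. -/
theorem zagierNumber_partial_recurrence (n m : ℕ) :
    (n + 2 : ℚ) ^ 2 * ∑ k ∈ Finset.range m,
      ((n + 2 : ℚ) ^ 2 * ((n + 2).choose k ^ 2 * k.centralBinom)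
        - (10 * (n + 1 : ℚ) ^ 2 + 10 * (n + 1) + 3) * ((n + 1).choose k ^ 2 * k.centralBinom)
        + 9 * (n + 1 : ℚ) ^ 2 * (n.choose k ^ 2 * k.centralBinom)) =
      m ^ 3 * (3 * m - 4 * (n + 2)) * (n + 2).choose m ^ 2 * m.centralBinom := by
  induction m with
  | zero => simp
  | succ m ih =>
    rw [Finset.sum_range_succ, mul_add, ih]
    have h1 := cast_choose_mul_succ (n + 1) m
    have h2 := cast_choose_mul_succ n m
    have h3 := cast_choose_succ_mul (n + 2) m
    have h4 := cast_centralBinom_succ m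
    push_cast at h1 h2 h3 ⊢
    set u := ((n + 2).choose m : ℚ)
    set c := (m.centralBinom : ℚ)
    have hn1 : (n : ℚ) + 1 ≠ 0 := by positivity
    have hn2 : (n : ℚ) + 2 ≠ 0 := by positivity
    have hm : (m : ℚ) + 1 ≠ 0 := by positivity
    have e1 : ((n + 1).choose m : ℚ) = (n + 2 - m) * u / (n + 2) := by
      field_simp; linear_combination h1
    have e2 : (n.choose m : ℚ) = (n + 1 - m) * (n + 2 - m) * u / ((n + 1) * (n + 2)) := by
      rw [eq_div_iff (by positivity)]
      rw [e1] at h2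
      field_simp at h2
      linear_combination h2
    have e3 : ((n + 2).choose (m + 1) : ℚ) = (n + 2 - m) * u / (m + 1) := by
      field_simp; linear_combination h3
    have e4 : ((m + 1).centralBinom : ℚ) = 2 * (2 * m + 1) * c / (m + 1) := by
      field_simp; linear_combination h4
    rw [e1, e2, e3, e4]
    field_simp
    ring

theorem zagierNumber_recurrence (n : ℕ) :
    (n + 2 : ℤ) ^ 2 * zagierNumber (n + 2)
      - (10 * (n + 1 : ℤ) ^ 2 + 10 * (n + 1) + 3) * zagierNumber (n + 1)
      + 9 * (n + 1 : ℤ) ^ 2 * zagierNumber n = 0 := by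
  have h := zagierNumber_partial_recurrence n (n + 3)
  rw [Nat.choose_eq_zero_of_lt (show n + 2 < n + 3 by omega), Finset.sum_add_distrib,
    Finset.sum_sub_distrib, ← Finset.mul_sum, ← Finset.mul_sum, ← Finset.mul_sum,
    ← zagierNumber_eq_sum (by omega), ← zagierNumber_eq_sum (by omega),
    ← zagierNumber_eq_sum (by omega)] at h
  have hn2 : (n + 2 : ℚ) ^ 2 ≠ 0 := by positivity
  have h' := (mul_eq_zero.1 (h.trans (by simp))).resolve_left hn2
  exact_mod_cast h'

/-- The product `(n choose k) (n + k choose n)`, whose squares sum to the Apéry numbers. -/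
def aperyTerm (n k : ℕ) : ℚ := n.choose k * (n + k).choose n

theorem aperyTerm_eq_zero {n k : ℕ} (h : n < k) : aperyTerm n k = 0 := by
  simp [aperyTerm, Nat.choose_eq_zero_of_lt h]

theorem aperyTerm_succ_left (n k : ℕ) :
    aperyTerm n k * (n + 1 + k) = (n + 1 - k) * aperyTerm (n + 1) k := by
  have h1 := cast_choose_mul_succ n k
  have h2 : ((n + 1 + k).choose (n + 1) : ℚ) * (n + 1) = (n + k + 1) * (n + k).choose n := by
    have := Nat.add_one_mul_choose_eq (n + k) n
    rw [show n + 1 + k = n + k + 1 by ring]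
    exact_mod_cast this.symm
  have hn1 : (n : ℚ) + 1 ≠ 0 := by positivity
  simp only [aperyTerm]
  apply mul_right_cancel₀ hn1
  linear_combination ((n + k).choose n : ℚ) * (n + 1 + k) * h1 -
    ((n : ℚ) + 1 - k) * (n + 1).choose k * h2

theorem aperyTerm_succ_succ (n k : ℕ) :
    aperyTerm (n + 1) (k + 1) * (k + 1) ^ 2 = (n + k + 2) * (n + k + 1) * aperyTerm n k := by
  have h1 : ((n + 1).choose (k + 1) : ℚ) * (k + 1) = (n + 1) * n.choose k := by
    exact_mod_cast (Nat.add_one_mul_choose_eq n k).symm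
  have h2 : ((n + k + 2).choose (n + 1) : ℚ) * (n + 1) = (n + k + 2) * (n + k + 1).choose n := by
    exact_mod_cast (Nat.add_one_mul_choose_eq (n + k + 1) n).symm
  have h3 : ((n + k + 1).choose n : ℚ) * (k + 1) = (n + k + 1) * (n + k).choose n := by
    have := Nat.choose_mul_succ_eq (n + k) n
    rw [show n + k + 1 - n = k + 1 by omega] at this
    have h : ((n + k).choose n : ℚ) * (n + k + 1) = (n + k + 1).choose n * (k + 1) := by
      exact_mod_cast this
    rw [← h]; ring
  have hn1 : (n : ℚ) + 1 ≠ 0 := by positivity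
  simp only [aperyTerm]
  rw [show n + 1 + (k + 1) = n + k + 2 by ring]
  apply mul_right_cancel₀ hn1
  linear_combination ((n + k + 2).choose (n + 1) : ℚ) * (n + 1) * (k + 1) * h1 +
    ((n : ℚ) + 1) * n.choose k * (k + 1) * h2 + (n + 1) * n.choose k * (n + k + 2) * h3

theorem aperyNumber_eq_sum {n m : ℕ} (h : n < m) :
    (aperyNumber n : ℚ) = ∑ k ∈ Finset.range m, aperyTerm n k ^ 2 := by
  rw [aperyNumber]
  push_cast
  simp only [← mul_pow]
  refine Finset.sum_subset (by simpa using h) fun k _ hk => ?_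
  rw [Nat.choose_eq_zero_of_lt (by simpa using hk)]; simp

/-- The classical telescoping certificate for Apéry's recurrence; it vanishes at m = n + 2. -/
theorem aperyNumber_partial_recurrence (n m : ℕ) :
    ∑ k ∈ Finset.range (m + 1), ((n + 2 : ℚ) ^ 3 * aperyTerm (n + 2) k ^ 2
        - (34 * (n + 1 : ℚ) ^ 3 + 51 * (n + 1) ^ 2 + 27 * (n + 1) + 5) * aperyTerm (n + 1) k ^ 2
        + (n + 1 : ℚ) ^ 3 * aperyTerm n k ^ 2) =
      4 * (2 * (n + 1) + 1) * (m * (2 * m + 1) - (2 * (n + 1) + 1) ^ 2) *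
        aperyTerm (n + 1) m ^ 2 := by
  induction m with
  | zero =>
    simp [aperyTerm]; ring
  | succ m ih =>
    rw [Finset.sum_range_succ, ih]
    have h1 := aperyTerm_succ_left (n + 1) (m + 1)
    have h2 := aperyTerm_succ_left n (m + 1)
    have h3 := aperyTerm_succ_succ (n + 1) m
    push_cast at h1 h2 h3 ⊢
    have hm : (m : ℚ) + 1 ≠ 0 := by positivity
    have hn2 : (n : ℚ) + m + 2 ≠ 0 := by positivity
    have hn3 : (n : ℚ) + m + 3 ≠ 0 := by positivity
    -- Expressing all terms through the one with the largest indices leaves only denominators that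
    -- never vanish.
    have e1 : aperyTerm (n + 1) (m + 1) =
        (n + 1 - m) * aperyTerm (n + 2) (m + 1) / (n + m + 3) := by
      rw [eq_div_iff hn3]; linear_combination h1
    have e2 : aperyTerm n (m + 1) =
        (n - m) * (n + 1 - m) * aperyTerm (n + 2) (m + 1) / ((n + m + 2) * (n + m + 3)) := by
      rw [eq_div_iff (mul_ne_zero hn2 hn3)]
      rw [e1] at h2
      field_simp at h2
      linear_combination h2
    have e3 : aperyTerm (n + 1) m =
        (m + 1) ^ 2 * aperyTerm (n + 2) (m + 1) / ((n + m + 2) * (n + m + 3)) := by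
      rw [eq_div_iff (mul_ne_zero hn2 hn3)]
      linear_combination -h3
    rw [e1, e2, e3]
    field_simp
    ring

theorem aperyNumber_recurrence (n : ℕ) :
    (n + 2 : ℤ) ^ 3 * aperyNumber (n + 2)
      - (34 * (n + 1 : ℤ) ^ 3 + 51 * (n + 1) ^ 2 + 27 * (n + 1) + 5) * aperyNumber (n + 1)
      + (n + 1 : ℤ) ^ 3 * aperyNumber n = 0 := by
  have h := aperyNumber_partial_recurrence n (n + 2)
  rw [aperyTerm_eq_zero (show n + 1 < n + 2 by omega), Finset.sum_add_distrib,
    Finset.sum_sub_distrib, ← Finset.mul_sum, ← Finset.mul_sum, ← Finset.mul_sum,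
    ← aperyNumber_eq_sum (by omega), ← aperyNumber_eq_sum (by omega),
    ← aperyNumber_eq_sum (by omega)] at h
  have h' := h.trans (show _ = (0 : ℚ) by simp)
  exact_mod_cast h'

/-! ### Differential equations and the level six uniformisation. -/

section EulerOperator

open PowerSeries

/-- The Euler operator `X d/dX` on power series. -/
noncomputable def eulerDerivation (R : Type*) [CommRing R] : Derivation R R⟦X⟧ R⟦X⟧ :=
  (X : R⟦X⟧) • PowerSeries.derivative R

local notation "θ" => eulerDerivation ℤ

theorem eulerDerivation_apply {R : Type*} [CommRing R] (f : R⟦X⟧) :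
    eulerDerivation R f = X * PowerSeries.derivative R f := rfl

theorem coeff_eulerDerivation {R : Type*} [CommRing R] (f : R⟦X⟧) (n : ℕ) :
    coeff n (eulerDerivation R f) = n * coeff n f := by
  rw [eulerDerivation_apply]
  cases n with
  | zero => simp
  | succ n => rw [coeff_succ_X_mul, coeff_derivative, mul_comm]; push_cast; rfl

theorem eulerDerivation_mul {R : Type*} [CommRing R] (f g : R⟦X⟧) :
    eulerDerivation R (f * g) = f * eulerDerivation R g + g * eulerDerivation R f := by
  simp [Derivation.leibniz]

theorem eulerDerivation_X {R : Type*} [CommRing R] : eulerDerivation R (X : R⟦X⟧) = X := by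
  simp [eulerDerivation_apply]

theorem eulerDerivation_ofNat {R : Type*} [CommRing R] (n : ℕ) [n.AtLeastTwo] :
    eulerDerivation R (ofNat(n) : R⟦X⟧) = 0 :=
  Derivation.map_natCast _ n

/-- A solution of a homogeneous linear equation of order one that vanishes at `0` is zero. -/
theorem eq_zero_of_eulerDerivation_eq {P S W : ℤ⟦X⟧} (h : P * θ W = W * S)
    (hP : constantCoeff P ≠ 0) (hS : constantCoeff S = 0) (hW : constantCoeff W = 0) : W = 0 := by
  by_contra hne
  obtain ⟨V, hV⟩ := X_pow_order_dvd (φ := W)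
  set n := W.order.toNat with hn_def
  clear_value n
  have hV0 : constantCoeff V ≠ 0 := by
    have := coeff_order hne
    rw [← hn_def] at this
    rwa [hV, coeff_X_pow_mul', if_pos le_rfl, Nat.sub_self, coeff_zero_eq_constantCoeff] at this
  have hn : n ≠ 0 := by
    intro hn
    rw [hV, hn] at hW
    exact hV0 (by simpa using hW)
  -- Lowest-order terms are compared: n P(0) V(0) on the left against V(0) S(0) = 0 on the right.
  have hθ : θ W = X ^ n * ((n : ℤ⟦X⟧) * V + θ V) := by
    rw [hV]
    ext k
    rw [coeff_eulerDerivation, coeff_X_pow_mul', coeff_X_pow_mul']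
    split_ifs with hk
    · rw [map_add, coeff_eulerDerivation, ← map_natCast (C (R := ℤ)), coeff_C_mul]
      push_cast [Nat.cast_sub hk]; ring
    · simp
  have hc : P * ((n : ℤ⟦X⟧) * V + θ V) = V * S := by
    have hX : (X : ℤ⟦X⟧) ^ n ≠ 0 := pow_ne_zero _ X_ne_zero
    apply mul_left_cancel₀ hX
    rw [hθ] at h
    linear_combination h + S * hV
  have := congrArg constantCoeff hc
  simp [hS, eulerDerivation_apply, hP, hn, hV0] at this

/-- The generating series of the Apéry numbers. -/
def aperyGenSeries : ℤ⟦X⟧ := PowerSeries.mk fun n => (aperyNumber n : ℤ)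

/-- The generating series of the numbers `zagierNumber n`. -/
def zagierGenSeries : ℤ⟦X⟧ := PowerSeries.mk fun n => (zagierNumber n : ℤ)

theorem coeff_ofNat_mul {R : Type*} [CommRing R] (k : ℕ) [k.AtLeastTwo] (f : R⟦X⟧) (n : ℕ) :
    coeff n (ofNat(k) * f) = ofNat(k) * coeff n f := by
  rw [← map_ofNat (C (R := R)), coeff_C_mul]

theorem zagierGenSeries_equation :
    (1 - X) * (1 - 9 * X) * θ (θ zagierGenSeries) =
      (10 * X - 18 * X ^ 2) * θ zagierGenSeries + (3 * X - 9 * X ^ 2) * zagierGenSeries := by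
  set F := zagierGenSeries with hF
  suffices h : θ (θ F) - X * (10 * θ (θ F) + 10 * θ F + 3 * F) +
      X * (X * (9 * (θ (θ F) + 2 * θ F + F))) = 0 by
    linear_combination h
  have hc (n : ℕ) : coeff n F = (zagierNumber n : ℤ) := by simp [hF, zagierGenSeries]
  ext n
  rcases n with _ | _ | n
  · simp [eulerDerivation_apply]
  · simp only [map_add, map_sub, coeff_succ_X_mul, coeff_zero_X_mul, coeff_ofNat_mul,
      coeff_eulerDerivation, hc]
    simp [show zagierNumber 0 = 1 from rfl, show zagierNumber 1 = 3 from rfl]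
  · have := zagierNumber_recurrence n
    simp only [map_add, map_sub, coeff_succ_X_mul, coeff_ofNat_mul, coeff_eulerDerivation, hc]
    simp only [map_zero]
    push_cast
    linear_combination this

theorem aperyGenSeries_equation :
    (1 - 34 * X + X ^ 2) * θ (θ (θ aperyGenSeries)) =
      (51 * X - 3 * X ^ 2) * θ (θ aperyGenSeries) + (27 * X - 3 * X ^ 2) * θ aperyGenSeries +
        (5 * X - X ^ 2) * aperyGenSeries := by
  set F := aperyGenSeries with hF
  suffices h : θ (θ (θ F)) - X * (34 * θ (θ (θ F)) + 51 * θ (θ F) + 27 * θ F + 5 * F) +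
      X * (X * (θ (θ (θ F)) + 3 * θ (θ F) + 3 * θ F + F)) = 0 by
    linear_combination h
  have hc (n : ℕ) : coeff n F = (aperyNumber n : ℤ) := by simp [hF, aperyGenSeries]
  ext n
  rcases n with _ | _ | n
  · simp [eulerDerivation_apply]
  · simp only [map_add, map_sub, coeff_succ_X_mul, coeff_zero_X_mul, coeff_ofNat_mul,
      coeff_eulerDerivation, hc]
    simp [show aperyNumber 0 = 1 from rfl, show aperyNumber 1 = 5 from rfl]
  · have := aperyNumber_recurrence n
    simp only [map_add, map_sub, coeff_succ_X_mul, coeff_ofNat_mul, coeff_eulerDerivation, hc]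
    simp only [map_zero]
    push_cast
    linear_combination this

theorem eq_zero_of_eulerDerivation_eq_zero {f : ℤ⟦X⟧} (h : θ f = 0) (h0 : constantCoeff f = 0) :
    f = 0 :=
  eq_zero_of_eulerDerivation_eq (P := 1) (S := 0) (by simp [h]) (by simp) (by simp) h0

/-- The generating series of the Apéry numbers is annihilated by the quadratic form attached to
the symmetric square structure of the Apéry differential equation. -/
theorem aperyGenSeries_quadratic_equation :
    (1 - 34 * X + X ^ 2) * (2 * aperyGenSeries * θ (θ aperyGenSeries) - θ aperyGenSeries ^ 2) +
      2 * X * (X - 17) * aperyGenSeries * θ aperyGenSeries +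
      X * (X - 10) * aperyGenSeries ^ 2 = 0 := by
  set F := aperyGenSeries with hF
  apply eq_zero_of_eulerDerivation_eq_zero
  -- The quadratic form is a first integral: its θ-derivative is 2F times the third-order equation.
  · have := aperyGenSeries_equation
    simp only [pow_two, map_add, map_sub, eulerDerivation_mul, eulerDerivation_X,
      eulerDerivation_ofNat, Derivation.map_one_eq_zero]
    rw [← hF] at this
    linear_combination 2 * F * this
  · simp [eulerDerivation_apply]

/-- The power series `x (1 - 9 x) / (1 - x)`. -/
noncomputable def levelSixMap (R : Type*) [CommRing R] : R⟦X⟧ := X * (1 - 9 * X) * PowerSeries.mk 1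

theorem one_sub_mul_levelSixMap (R : Type*) [CommRing R] :
    (1 - X) * levelSixMap R = X * (1 - 9 * X) := by
  have := PowerSeries.mk_one_mul_one_sub_eq_one R
  rw [levelSixMap]
  linear_combination X * (1 - 9 * X) * this

theorem constantCoeff_levelSixMap (R : Type*) [CommRing R] :
    constantCoeff (levelSixMap R) = 0 := by
  simp [levelSixMap]

theorem hasSubst_levelSixMap (R : Type*) [CommRing R] : HasSubst (levelSixMap R) :=
  HasSubst.of_constantCoeff_zero' (constantCoeff_levelSixMap R)

/-- The chain rule, with x t'/t = (1 - 18x + 9x²) / ((1 - x)(1 - 9x)). -/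
theorem eulerDerivation_subst_levelSixMap (h : ℤ⟦X⟧) :
    (1 - 18 * X + 9 * X ^ 2) * (θ h).subst (levelSixMap ℤ) =
      (1 - X) * (1 - 9 * X) * θ (h.subst (levelSixMap ℤ)) := by
  have hT := hasSubst_levelSixMap ℤ
  have h1 := one_sub_mul_levelSixMap ℤ
  have h2 := congrArg (PowerSeries.derivative ℤ) h1
  simp only [Derivation.leibniz, map_sub, Derivation.map_one_eq_zero, derivative_X, smul_eq_mul,
    show PowerSeries.derivative ℤ (9 : ℤ⟦X⟧) = 0 from Derivation.map_natCast _ 9] at h2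
  rw [eulerDerivation_apply, eulerDerivation_apply, subst_mul hT, subst_X hT,
    derivative_subst hT]
  set T := levelSixMap ℤ
  set T' := PowerSeries.derivative ℤ T
  set h' := (PowerSeries.derivative ℤ h).subst T
  have hw : (1 - X : ℤ⟦X⟧) ≠ 0 := fun h => by
    have := congrArg constantCoeff h
    simp at this
  have h3 : (1 - X) ^ 2 * T' = 1 - 18 * X + 9 * X ^ 2 := by
    linear_combination (1 - X) * h2 + h1
  apply mul_left_cancel₀ hw
  linear_combination (1 - 18 * X + 9 * X ^ 2) * h' * h1 - X * (1 - 9 * X) * h' * h3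

/-- The quadratic differential equation of the Apéry series, pulled back along
`x ↦ x (1 - 9 x) / (1 - x)`. -/
def IsPullbackSolution (g : ℤ⟦X⟧) : Prop :=
  (1 - 18 * X + 9 * X ^ 2) * ((1 - X) * (1 - 9 * X)) ^ 2 * (2 * g * θ (θ g) - θ g ^ 2) +
    (1 - X) * (1 - 9 * X) * (2 * (1 - 18 * X + 9 * X ^ 2) * (-10 * X + 18 * X ^ 2)
      - 2 * (1 - X) * (1 - 9 * X) * (-18 * X + 18 * X ^ 2)
      + 2 * (X * (1 - 9 * X)) * (X * (1 - 9 * X) - 17 * (1 - X))) * g * θ g +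
    (1 - 18 * X + 9 * X ^ 2) * (X * (1 - 9 * X)) * (X * (1 - 9 * X) - 10 * (1 - X)) * g ^ 2 = 0

theorem isPullbackSolution_apery :
    IsPullbackSolution (aperyGenSeries.subst (levelSixMap ℤ)) := by
  have hT := hasSubst_levelSixMap ℤ
  have hwT := one_sub_mul_levelSixMap ℤ
  have e0 := congrArg (fun h => h.subst (levelSixMap ℤ)) aperyGenSeries_quadratic_equation
  have h1 := eulerDerivation_subst_levelSixMap aperyGenSeries
  have h2 := eulerDerivation_subst_levelSixMap (θ aperyGenSeries)
  simp only [← coe_substAlgHom hT] at e0 h1 h2 ⊢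
  simp only [map_add, map_sub, map_mul, map_pow, map_one, map_ofNat, map_zero] at e0
  rw [show substAlgHom hT (X : ℤ⟦X⟧) = levelSixMap ℤ from substAlgHom_X hT] at e0
  set T := levelSixMap ℤ
  set g := substAlgHom hT aperyGenSeries
  set g₁ := substAlgHom hT (θ aperyGenSeries)
  set g₂ := substAlgHom hT (θ (θ aperyGenSeries))
  have h3 := congrArg θ h1
  simp only [pow_two, map_add, map_sub, eulerDerivation_mul, eulerDerivation_X,
      eulerDerivation_ofNat, Derivation.map_one_eq_zero] at h3
  have e1 : (1 - 18 * X + 9 * X ^ 2) ^ 2 * (2 * g * g₂ - g₁ ^ 2) +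
      2 * (X * (1 - 9 * X)) * (X * (1 - 9 * X) - 17 * (1 - X)) * g * g₁ +
      (X * (1 - 9 * X)) * (X * (1 - 9 * X) - 10 * (1 - X)) * g ^ 2 = 0 := by
    -- On the cover, t² - 34t + 1 becomes a square up to (1 - x)²: its roots are the critical values
    -- of x ↦ t.
    have hq : (1 - 18 * X + 9 * X ^ 2 : ℤ⟦X⟧) ^ 2 = (1 - X) ^ 2
      - 34 * (1 - X) * (X * (1 - 9 * X)) + (X * (1 - 9 * X)) ^ 2 := by ring
    rw [hq, ← hwT]
    linear_combination (1 - X) ^ 2 * e0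
  have e2 : (1 - 18 * X + 9 * X ^ 2) ^ 3 * g₂ = (1 - X) * (1 - 9 * X) *
      ((1 - 18 * X + 9 * X ^ 2) * (-10 * X + 18 * X ^ 2) * θ g +
      (1 - 18 * X + 9 * X ^ 2) * ((1 - X) * (1 - 9 * X)) * θ (θ g) -
      (1 - X) * (1 - 9 * X) * (-18 * X + 18 * X ^ 2) * θ g) := by
    linear_combination (1 - 18 * X + 9 * X ^ 2) ^ 2 * h2 +
      (1 - 18 * X + 9 * X ^ 2) * ((1 - X) * (1 - 9 * X)) * h3 -
      (1 - X) * (1 - 9 * X) * (-18 * X + 18 * X ^ 2) * h1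
  unfold IsPullbackSolution
  linear_combination (1 - 18 * X + 9 * X ^ 2) * e1 - 2 * g * e2 +
    ((1 - 18 * X + 9 * X ^ 2) * ((1 - 18 * X + 9 * X ^ 2) * g₁ + (1 - X) * (1 - 9 * X) * θ g) -
      2 * (X * (1 - 9 * X)) * (X * (1 - 9 * X) - 17 * (1 - X)) * g) * h1

/-- For y = F² one has 2y θ²y - (θy)² = 4F³ θ²F, so the quadratic equation reduces to a multiple of
F³ times the second-order equation of F. -/
theorem isPullbackSolution_zagier :
    IsPullbackSolution ((1 - X) * zagierGenSeries ^ 2) := by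
  have h := zagierGenSeries_equation
  set F := zagierGenSeries
  simp only [IsPullbackSolution, pow_two (F), map_add, map_sub, eulerDerivation_mul,
    eulerDerivation_X, Derivation.map_one_eq_zero, map_zero]
  linear_combination 4 * (1 - X) ^ 2 * F ^ 3 * (1 - 18 * X + 9 * X ^ 2) *
    ((1 - X) * (1 - 9 * X)) * h

/-- Eliminating the zeroth-order terms leaves a first-order linear equation for the Wronskian, which
vanishes at 0 because θ kills constant terms. So the Wronskian is zero, and then so is g₁ - g₂ by
the same principle. -/
theorem IsPullbackSolution.eq {g₁ g₂ : ℤ⟦X⟧} (h₁ : IsPullbackSolution g₁)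
    (h₂ : IsPullbackSolution g₂) (c₁ : constantCoeff g₁ = 1) (c₂ : constantCoeff g₂ = 1) :
    g₁ = g₂ := by
  have hW : θ g₁ * g₂ - g₁ * θ g₂ = 0 := by
    unfold IsPullbackSolution at h₁ h₂
    set P₂ : ℤ⟦X⟧ := (1 - 18 * X + 9 * X ^ 2) * ((1 - X) * (1 - 9 * X)) ^ 2 with hP₂
    set P₁ : ℤ⟦X⟧ := (1 - X) * (1 - 9 * X) * (2 * (1 - 18 * X + 9 * X ^ 2) * (-10 * X + 18 * X ^ 2)
      - 2 * (1 - X) * (1 - 9 * X) * (-18 * X + 18 * X ^ 2)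
      + 2 * (X * (1 - 9 * X)) * (X * (1 - 9 * X) - 17 * (1 - X))) with hP₁
    apply eq_zero_of_eulerDerivation_eq (P := 2 * P₂ * g₁ * g₂)
      (S := P₂ * (g₂ * θ g₁ + g₁ * θ g₂) - P₁ * g₁ * g₂)
    · simp only [map_sub, eulerDerivation_mul]
      linear_combination g₂ ^ 2 * h₁ - g₁ ^ 2 * h₂
    · have : constantCoeff (2 : ℤ⟦X⟧) = 2 := map_ofNat _ 2
      simp [c₁, c₂, hP₂, this]
    · simp [hP₁, eulerDerivation_apply]
    · simp [eulerDerivation_apply]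
  apply sub_eq_zero.1
  apply eq_zero_of_eulerDerivation_eq (P := g₂) (S := θ g₂)
  · rw [map_sub]
    linear_combination hW
  · simp [c₂]
  · simp [eulerDerivation_apply]
  · simp [c₁, c₂]

theorem constantCoeff_aperyGenSeries : constantCoeff aperyGenSeries = 1 := by
  rw [← coeff_zero_eq_constantCoeff_apply, aperyGenSeries, coeff_mk]; rfl

theorem constantCoeff_zagierGenSeries : constantCoeff zagierGenSeries = 1 := by
  rw [← coeff_zero_eq_constantCoeff_apply, zagierGenSeries, coeff_mk]; rfl

/-- The generating series of the Apéry numbers is, up to a change of variables, the square of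
that of the numbers `zagierNumber n`. -/
theorem aperyGenSeries_subst :
    aperyGenSeries.subst (levelSixMap ℤ) = (1 - X) * zagierGenSeries ^ 2 := by
  apply isPullbackSolution_apery.eq isPullbackSolution_zagier
  · have h := constantCoeff_subst_eq_zero (constantCoeff_levelSixMap ℤ) (aperyGenSeries - 1)
      (by simp [constantCoeff_aperyGenSeries])
    rw [← coe_substAlgHom (hasSubst_levelSixMap ℤ), map_sub, map_one, map_sub, sub_eq_zero] at h
    rw [← coe_substAlgHom (hasSubst_levelSixMap ℤ)]
    exact h.trans (map_one _)
  · simp [constantCoeff_zagierGenSeries]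

end EulerOperator

/-! ### Lucas congruences. -/

theorem Finset.sum_range_mul_eq_sum_sum {M : Type*} [AddCommMonoid M] (f : ℕ → M) (p m : ℕ) :
    ∑ k ∈ Finset.range (p * m), f k =
      ∑ i ∈ Finset.range m, ∑ j ∈ Finset.range p, f (p * i + j) := by
  induction m with
  | zero => simp
  | succ m ih => rw [Nat.mul_succ, Finset.sum_range_add, ih, Finset.sum_range_succ]

/-- A sequence of sums satisfies the Lucas congruences if its summands do. -/
theorem sum_lucas {R : Type*} [CommRing R] {p : ℕ} (c : ℕ → ℕ → R)
    (hc : ∀ m r i j, r < p → j < p → c (p * m + r) (p * i + j) = c m i * c r j)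
    (h0 : ∀ n k, n < k → c n k = 0) (m r : ℕ) (hr : r < p) :
    ∑ k ∈ Finset.range (p * m + r + 1), c (p * m + r) k =
      (∑ k ∈ Finset.range (m + 1), c m k) * ∑ k ∈ Finset.range (r + 1), c r k := by
  have hext : ∀ n N, n < N → ∑ k ∈ Finset.range (n + 1), c n k = ∑ k ∈ Finset.range N, c n k :=
    fun n N h => Finset.sum_subset (by simpa using h) fun k _ hk => h0 _ _ (by simpa using hk)
  rw [hext _ (p * (m + 1)) (by rw [Nat.mul_succ]; omega), hext r p hr,
    Finset.sum_range_mul_eq_sum_sum, Finset.sum_mul]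
  refine Finset.sum_congr rfl fun i _ => ?_
  rw [Finset.mul_sum]
  exact Finset.sum_congr rfl fun j hj => hc _ _ _ _ hr (by simpa using hj)

section Lucas

variable {p : ℕ} [Fact p.Prime]

theorem cast_choose_lucas (m r i j : ℕ) (hr : r < p) (hj : j < p) :
    ((p * m + r).choose (p * i + j) : ZMod p) = m.choose i * r.choose j := by
  have h := Choose.choose_modEq_choose_mod_mul_choose_div_nat (n := p * m + r) (k := p * i + j)
    (p := p)
  have hp : 0 < p := (Fact.out : p.Prime).pos
  rw [Nat.mul_add_mod, Nat.mul_add_mod, Nat.mod_eq_of_lt hr, Nat.mod_eq_of_lt hj,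
    Nat.mul_add_div hp, Nat.mul_add_div hp, Nat.div_eq_of_lt hr, Nat.div_eq_of_lt hj, add_zero,
    add_zero, ← ZMod.natCast_eq_natCast_iff] at h
  rw [h]; push_cast; ring

/-- A carry in r + j leaves the last digit r + j - p < r, so the last factor in Lucas' theorem is
zero. -/
theorem cast_choose_add_eq_zero {r j : ℕ} (hr : r < p) (hj : j < p) (h : p ≤ r + j) (a b : ℕ) :
    ((p * a + (r + j)).choose (p * b + r) : ZMod p) = 0 := by
  obtain ⟨s, hs⟩ := Nat.exists_eq_add_of_le h
  rw [hs, ← add_assoc, ← Nat.mul_succ, cast_choose_lucas _ _ _ _ (by omega) hr,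
    Nat.choose_eq_zero_of_lt (show s < r by omega)]
  simp

theorem cast_aperyNumber_lucas (m r : ℕ) (hr : r < p) :
    (aperyNumber (p * m + r) : ZMod p) = aperyNumber m * aperyNumber r := by
  have := sum_lucas (R := ZMod p) (p := p)
    (fun n k => (n.choose k : ZMod p) ^ 2 * ((n + k).choose n : ZMod p) ^ 2) ?_ ?_ m r hr
  · simpa only [aperyNumber, Nat.cast_sum, Nat.cast_mul, Nat.cast_pow] using this
  · intro m r i j hr hj
    rw [cast_choose_lucas _ _ _ _ hr hj,
      show p * m + r + (p * i + j) = p * (m + i) + (r + j) by ring]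
    rcases lt_or_ge (r + j) p with h | h
    · rw [cast_choose_lucas _ _ _ _ h hr]; ring
    · have h0 := cast_choose_add_eq_zero hr hj h 0 0
      simp only [mul_zero, zero_add] at h0
      rw [cast_choose_add_eq_zero hr hj h, h0]; ring
  · intro n k h
    simp [Nat.choose_eq_zero_of_lt h]

theorem cast_zagierNumber_lucas (m r : ℕ) (hr : r < p) :
    (zagierNumber (p * m + r) : ZMod p) = zagierNumber m * zagierNumber r := by
  have := sum_lucas (R := ZMod p) (p := p)
    (fun n k => (n.choose k : ZMod p) ^ 2 * ((k + k).choose k : ZMod p)) ?_ ?_ m r hr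
  · simpa only [zagierNumber, Nat.centralBinom, two_mul, Nat.cast_sum, Nat.cast_mul, Nat.cast_pow]
      using this
  · intro m r i j hr hj
    rw [cast_choose_lucas _ _ _ _ hr hj,
      show p * i + j + (p * i + j) = p * (i + i) + (j + j) by ring]
    rcases lt_or_ge (j + j) p with h | h
    · rw [cast_choose_lucas _ _ _ _ h hj]; ring
    · have h0 := cast_choose_add_eq_zero hj hj h 0 0
      simp only [mul_zero, zero_add] at h0
      rw [cast_choose_add_eq_zero hj hj h, h0]; ring
  · intro n k h
    simp [Nat.choose_eq_zero_of_lt h]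

open PowerSeries

/-- Frobenius fixes the coefficients, which lie in 𝔽_p. -/
theorem powerSeries_pow_char (f : (ZMod p)⟦X⟧) :
    f ^ p = f.expand p (Fact.out : p.Prime).ne_zero := by
  have h := MvPowerSeries.map_frobenius_expand (R := ZMod p) p (Fact.out : p.Prime).ne_zero (f := f)
  rw [ZMod.frobenius_zmod] at h
  rw [← h]
  rfl

/-- The generating series of a sequence with the Lucas property is the product of its truncation
and its own `p`-th power. -/
theorem eq_trunc_mul_pow_of_lucas (f : (ZMod p)⟦X⟧)
    (h : ∀ m r, r < p → coeff (p * m + r) f = coeff m f * coeff r f) :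
    f = (trunc p f : (ZMod p)⟦X⟧) * f ^ p := by
  have hp : 0 < p := (Fact.out : p.Prime).pos
  ext n
  -- The truncation lives in degrees below p and f^p in multiples of p, so only the division of n by
  -- p contributes.
  rw [powerSeries_pow_char, coeff_mul, Finset.sum_eq_single (n % p, p * (n / p))]
  · nth_rewrite 1 [← Nat.div_add_mod n p]
    rw [h _ _ (Nat.mod_lt _ hp), coeff_expand_mul, Polynomial.coeff_coe, coeff_trunc,
      if_pos (Nat.mod_lt _ hp), mul_comm]
  · rintro ⟨i, j⟩ hij hne
    rw [Finset.HasAntidiagonal.mem_antidiagonal] at hij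
    simp only at hij ⊢
    by_cases hj : p ∣ j
    · obtain ⟨k, rfl⟩ := hj
      rw [Polynomial.coeff_coe, coeff_trunc, if_neg, zero_mul]
      intro hi
      apply hne
      rw [← hij, Nat.add_mul_mod_self_left, Nat.mod_eq_of_lt hi, Nat.add_mul_div_left _ _ hp,
        Nat.div_eq_of_lt hi, zero_add]
    · rw [coeff_expand_of_not_dvd _ _ _ hj, mul_zero]
  · intro hn
    exact absurd (Finset.HasAntidiagonal.mem_antidiagonal.2 (Nat.mod_add_div n p)) hn

end Lucas

/-! ### Truncations modulo p. -/

/-- The reduction modulo `p` of the generating series of the numbers `zagierNumber n`. -/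
def zagierSeries (p : ℕ) : (ZMod p)⟦X⟧ :=
  PowerSeries.mk fun n => (zagierNumber n : ZMod p)

/-- The truncation of the reduced Apéry series to degree less than `p`. -/
noncomputable def aperyPoly (p : ℕ) : Polynomial (ZMod p) := (aperySeries p).trunc p

/-- The truncation of the reduced series `zagierSeries p` to degree less than `p`. -/
noncomputable def zagierPoly (p : ℕ) : Polynomial (ZMod p) := (zagierSeries p).trunc p

section Reduction

open PowerSeries

theorem aperySeries_eq_map (p : ℕ) :
    aperySeries p = aperyGenSeries.map (Int.castRingHom (ZMod p)) := by
  ext n; simp [aperySeries, aperyGenSeries]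

theorem zagierSeries_eq_map (p : ℕ) :
    zagierSeries p = zagierGenSeries.map (Int.castRingHom (ZMod p)) := by
  ext n; simp [zagierSeries, zagierGenSeries]

theorem map_levelSixMap {R S : Type*} [CommRing R] [CommRing S] (h : R →+* S) :
    (levelSixMap R).map h = levelSixMap S := by
  have h1 : (PowerSeries.mk 1 : R⟦X⟧).map h = PowerSeries.mk 1 := by ext n; simp
  have h2 : (9 : R⟦X⟧).map h = 9 := map_ofNat _ 9
  simp [levelSixMap, h1, h2]

theorem aperySeries_subst (p : ℕ) :
    (aperySeries p).subst (levelSixMap (ZMod p)) = (1 - X) * zagierSeries p ^ 2 := by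
  have h := congrArg (PowerSeries.map (Int.castRingHom (ZMod p))) aperyGenSeries_subst
  have h' := map_subst (hasSubst_levelSixMap ℤ) (h := Int.castRingHom (ZMod p)) aperyGenSeries
  rw [aperySeries_eq_map, zagierSeries_eq_map, ← map_levelSixMap (Int.castRingHom (ZMod p))]
  refine h'.symm.trans (h.trans ?_)
  simp

variable {p : ℕ} [Fact p.Prime]

theorem aperySeries_eq_mul_pow :
    aperySeries p = (aperyPoly p : (ZMod p)⟦X⟧) * aperySeries p ^ p :=
  eq_trunc_mul_pow_of_lucas _ fun m r hr => by
    simpa [aperySeries] using cast_aperyNumber_lucas m r hr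

theorem zagierSeries_eq_mul_pow :
    zagierSeries p = (zagierPoly p : (ZMod p)⟦X⟧) * zagierSeries p ^ p :=
  eq_trunc_mul_pow_of_lucas _ fun m r hr => by
    simpa [zagierSeries] using cast_zagierNumber_lucas m r hr

theorem one_sub_X_ne_zero : (1 - X : (ZMod p)⟦X⟧) ≠ 0 := fun h => by
  have := congrArg constantCoeff h
  simp at this

theorem zagierSeries_ne_zero : zagierSeries p ≠ 0 := fun h => by
  have := congrArg (coeff 0) h
  simp [zagierSeries, zagierNumber] at this

/-- Substitute f(t) = (1 - x) F² into f = A f^p, compare with the square of F = H F^p, and cancel (1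
- x) F^(2p). -/
theorem zagierPoly_sq :
    (zagierPoly p : (ZMod p)⟦X⟧) ^ 2 =
      (1 - X) ^ (p - 1) * Polynomial.aeval (levelSixMap (ZMod p)) (aperyPoly p) := by
  have hT := hasSubst_levelSixMap (ZMod p)
  have h1 := congrArg (fun f => f.subst (levelSixMap (ZMod p))) (aperySeries_eq_mul_pow (p := p))
  rw [subst_mul hT, subst_pow hT, aperySeries_subst, subst_coe hT] at h1
  have h2 := zagierSeries_eq_mul_pow (p := p)
  have hF := zagierSeries_ne_zero (p := p)
  set F := zagierSeries p
  set A := Polynomial.aeval (levelSixMap (ZMod p)) (aperyPoly p)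
  have h3 : (1 - X) * F ^ (2 * p) ≠ 0 := mul_ne_zero one_sub_X_ne_zero (pow_ne_zero _ hF)
  apply mul_left_cancel₀ h3
  have h4 : F ^ 2 = (zagierPoly p : (ZMod p)⟦X⟧) ^ 2 * F ^ (2 * p) := by
    nth_rewrite 1 [h2]; ring
  have h5 : (1 - X : (ZMod p)⟦X⟧) ^ p = (1 - X) ^ (p - 1) * (1 - X)  :=
    (pow_sub_one_mul (Fact.out : p.Prime).ne_zero _).symm
  have h6 : ((1 - X) * F ^ 2) ^ p = (1 - X) ^ p * F ^ (2 * p) := by rw [mul_pow, ← pow_mul]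
  rw [h6, h5] at h1
  linear_combination h1 - (1 - X) * h4

end Reduction

/-! ### Boundary values of the truncations. -/

section SpecialValues

variable {p : ℕ} [Fact p.Prime]

theorem natCast_zmod_ne_zero {n : ℕ} (h0 : n ≠ 0) (h : n < p) : (n : ZMod p) ≠ 0 := fun h' =>
  absurd (Nat.le_of_dvd (Nat.pos_of_ne_zero h0) ((ZMod.natCast_eq_zero_iff _ _).1 h')) (not_le.2 h)

theorem cast_two_mul_half (hp : p ≠ 2) : (2 : ZMod p) * ((p / 2 : ℕ) : ZMod p) = -1 := by
  have h := (Fact.out : p.Prime).eq_two_or_odd'.resolve_left hp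
  have h2 : 2 * (p / 2) + 1 = p := Nat.two_mul_div_two_add_one_of_odd h
  have h3 := congrArg (Nat.cast : ℕ → ZMod p) h2
  push_cast at h3
  rw [ZMod.natCast_self] at h3
  linear_combination h3

/-- The central binomial coefficient is (-4)^k (-1/2 choose k), and (p - 1)/2 ≡ -1/2. -/
theorem cast_centralBinom_eq (hp : p ≠ 2) {k : ℕ} (hk : k < p) :
    (k.centralBinom : ZMod p) = (-4) ^ k * (p / 2).choose k := by
  induction k with
  | zero => simp
  | succ k ih =>
    have ih := ih (by omega)
    have hk0 : ((k + 1 : ℕ) : ZMod p) ≠ 0 := natCast_zmod_ne_zero (by omega) hk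
    apply mul_left_cancel₀ hk0
    have h1 := congrArg (Nat.cast : ℕ → ZMod p) (Nat.succ_mul_centralBinom_succ k)
    have h3 : ((p / 2).choose (k + 1) : ZMod p) * (k + 1) = ((p / 2 : ℕ) - k) * (p / 2).choose k := by
      have h2 := congrArg (Int.cast : ℤ → ZMod p) (show ((p / 2).choose (k + 1) : ℤ) * (k + 1) =
        ((p / 2 : ℕ) - k) * (p / 2).choose k by exact_mod_cast cast_choose_succ_mul (p / 2) k)
      push_cast at h2
      exact_mod_cast h2
    push_cast at h1 ⊢
    rw [h1, ih, pow_succ]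
    linear_combination (4 * (-4) ^ k) * h3 + 2 * (-4) ^ k * (p / 2).choose k *
      cast_two_mul_half hp

theorem cast_centralBinom_eq_zero (hp : p ≠ 2) {k : ℕ} (hk : k < p) (h : p / 2 < k) :
    (k.centralBinom : ZMod p) = 0 := by
  rw [cast_centralBinom_eq hp hk, Nat.choose_eq_zero_of_lt h]; simp

/-- Negation of the upper index, with -k - 1 ≡ p - 1 - k. -/
theorem cast_choose_add_eq {k j : ℕ} (h : k + j < p) :
    ((k + j).choose k : ZMod p) = (-1) ^ j * (p - 1 - k).choose j := by
  induction j with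
  | zero => simp
  | succ j ih =>
    have ih := ih (by omega)
    have hj0 : ((j + 1 : ℕ) : ZMod p) ≠ 0 := natCast_zmod_ne_zero (by omega) (by omega)
    apply mul_left_cancel₀ hj0
    have h1 : ((k + j + 1).choose k : ZMod p) * (j + 1) = (k + j + 1) * (k + j).choose k := by
      have := Nat.choose_mul_succ_eq (k + j) k
      rw [show k + j + 1 - k = j + 1 by omega] at this
      have := congrArg (Nat.cast : ℕ → ZMod p) this
      push_cast at this
      linear_combination -this
    have h2 := congrArg (Nat.cast : ℕ → ZMod p) (Nat.choose_succ_right_eq (p - 1 - k) j)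
    have h3 : ((p - 1 - k - j : ℕ) : ZMod p) = -(k + j + 1) := by
      have : (p - 1 - k - j) + (k + j + 1) = p := by omega
      have := congrArg (Nat.cast : ℕ → ZMod p) this
      push_cast at this
      rw [ZMod.natCast_self] at this
      linear_combination this
    push_cast at h2 ⊢
    rw [h3] at h2
    rw [← add_assoc, pow_succ]
    linear_combination h1 + (k + j + 1) * ih + (-1) ^ j * h2

/-- Since (p-1 choose k)² ≡ 1, the sum is the binomial expansion of (1 - 4)^((p-1)/2). -/
theorem cast_zagierNumber_sub_one (hp : p ≠ 2) :
    (zagierNumber (p - 1) : ZMod p) = (-3) ^ (p / 2) := by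
  have hp1 : p - 1 + 1 = p := Nat.succ_pred_prime Fact.out
  have h2 : p / 2 + 1 ≤ p := by have := (Fact.out : p.Prime).two_le; omega
  rw [zagierNumber, hp1]
  push_cast
  have : ∀ k ∈ Finset.range p, ((p - 1).choose k : ZMod p) ^ 2 * k.centralBinom =
      (-4) ^ k * (p / 2).choose k := by
    intro k hk
    rw [Finset.mem_range] at hk
    have h := cast_choose_add_eq (p := p) (k := 0) (j := k) (by omega)
    rw [Nat.choose_zero_right, Nat.sub_zero] at h
    have h' : ((p - 1).choose k : ZMod p) ^ 2 = 1 := by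
      have h3 : ((-1 : ZMod p) ^ k) ^ 2 = 1 := by rw [← pow_mul, mul_comm, pow_mul]; simp
      have h4 := congrArg (· ^ 2) h
      simp only [mul_pow, h3] at h4
      simpa using h4.symm
    rw [h', one_mul, cast_centralBinom_eq hp hk]
  rw [Finset.sum_congr rfl this, ← Finset.sum_subset (Finset.range_mono h2)]
  · rw [show (-3 : ZMod p) = -4 + 1 by norm_num, add_pow]
    simp
  · intro k _ hk
    rw [Nat.choose_eq_zero_of_lt (by simpa using hk)]; simp

theorem sum_cast_choose_sq {k : ℕ} (hk : k < p) :
    ∑ n ∈ Finset.range p, (n.choose k : ZMod p) ^ 2 = ((p - 1 - k).centralBinom : ZMod p) := by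
  have h := congrArg (Nat.cast : ℕ → ZMod p) (Nat.sum_range_choose_sq (p - 1 - k))
  push_cast at h
  rw [Nat.centralBinom, ← h]
  obtain ⟨M, hM⟩ : ∃ M, p - 1 - k = M := ⟨_, rfl⟩
  have hp : Finset.range p = Finset.range (k + (M + 1)) := by congr 1; omega
  rw [hp, Finset.sum_range_add, Finset.sum_eq_zero, zero_add, hM]
  · refine Finset.sum_congr rfl fun j hj => ?_
    rw [Finset.mem_range] at hj
    rw [cast_choose_add_eq (by omega), hM, mul_pow, ← pow_mul, mul_comm j, pow_mul]
    simp
  · intro n hn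
    rw [Nat.choose_eq_zero_of_lt (by simpa using hn)]; simp

/-- Summing over n first leaves products of the central binomial coefficients of k and p - 1 - k.
One of them vanishes unless k = (p - 1)/2, where the product is 4^(p-1) = 1. -/
theorem sum_cast_zagierNumber (hp : p ≠ 2) :
    ∑ n ∈ Finset.range p, (zagierNumber n : ZMod p) = 1 := by
  have h1 : ∀ n ∈ Finset.range p, (zagierNumber n : ZMod p) =
      ∑ k ∈ Finset.range p, (n.choose k : ZMod p) ^ 2 * k.centralBinom := by
    intro n hn
    rw [zagierNumber]
    push_cast
    refine Finset.sum_subset (by simpa using hn) fun k _ hk => ?_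
    rw [Nat.choose_eq_zero_of_lt (by simpa using hk)]; simp
  have hodd := (Fact.out : p.Prime).eq_two_or_odd'.resolve_left hp
  have h2 : 2 * (p / 2) + 1 = p := Nat.two_mul_div_two_add_one_of_odd hodd
  rw [Finset.sum_congr rfl h1, Finset.sum_comm, Finset.sum_eq_single (p / 2)]
  · rw [← Finset.sum_mul, sum_cast_choose_sq (by omega), show p - 1 - p / 2 = p / 2 by omega,
      cast_centralBinom_eq hp (by omega), Nat.choose_self, Nat.cast_one, mul_one, ← mul_pow,
      show (-4 : ZMod p) * -4 = 4 ^ 2 by norm_num, ← pow_mul,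
      show 2 * (p / 2) = p - 1 by omega]
    apply ZMod.pow_card_sub_one_eq_one
    rw [show (4 : ZMod p) = 2 ^ 2 by norm_num]
    apply pow_ne_zero
    exact_mod_cast natCast_zmod_ne_zero (p := p) (n := 2) (by omega)
      (by have := (Fact.out : p.Prime).two_le; omega)
  · intro k hk hne
    rw [Finset.mem_range] at hk
    rw [← Finset.sum_mul, sum_cast_choose_sq hk]
    rcases lt_or_gt_of_ne hne with h | h
    · rw [cast_centralBinom_eq_zero hp (k := p - 1 - k) (by omega) (by omega), zero_mul]
    · rw [cast_centralBinom_eq_zero hp hk h, mul_zero]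
  · intro h
    exact absurd (Finset.mem_range.2 (by omega)) h

/-- Every term with k > 0 dies by a carry in p - 1 + k. Hence A has degree exactly p - 1. -/
theorem cast_aperyNumber_sub_one : (aperyNumber (p - 1) : ZMod p) = 1 := by
  have hp1 : p - 1 + 1 = p := Nat.succ_pred_prime Fact.out
  rw [aperyNumber, hp1]
  push_cast
  rw [Finset.sum_eq_single 0]
  · simp
  · intro k hk hk0
    rw [Finset.mem_range] at hk
    have := cast_choose_add_eq_zero (p := p) (r := p - 1) (j := k) (by omega) hk (by omega) 0 0
    simp only [mul_zero, zero_add] at this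
    rw [this]; ring
  · intro h
    exact absurd (Finset.mem_range.2 (Fact.out : p.Prime).pos) h

end SpecialValues

/-! ### Pulling polynomials back to the double cover. -/

section Polynomials

open Polynomial

/-- The numerator of `U (x (1 - 9 x) / (1 - x))` with respect to the denominator `(1 - x) ^ M`. -/
noncomputable def levelSixPoly {R : Type*} [CommRing R] (M : ℕ) (U : R[X]) : R[X] :=
  ∑ j ∈ Finset.range (M + 1), C (U.coeff j) * (X * (1 - 9 * X)) ^ j * (1 - X) ^ (M - j)

theorem coe_levelSixPoly {R : Type*} [CommRing R] {M : ℕ} {U : R[X]} (hU : U.natDegree ≤ M) :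
    (levelSixPoly M U : R⟦X⟧) = (1 - PowerSeries.X) ^ M * aeval (levelSixMap R) U := by
  have h9 : ((9 : R[X]) : R⟦X⟧) = 9 := map_ofNat Polynomial.coeToPowerSeries.ringHom 9
  rw [aeval_eq_sum_range' (Nat.lt_succ_of_le hU), Finset.mul_sum, levelSixPoly,
    ← Polynomial.coeToPowerSeries.ringHom_apply, map_sum]
  refine Finset.sum_congr rfl fun j hj => ?_
  obtain ⟨i, rfl⟩ := Nat.exists_eq_add_of_le (Nat.lt_succ_iff.1 (Finset.mem_range.1 hj))
  have h := one_sub_mul_levelSixMap R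
  simp only [Polynomial.coeToPowerSeries.ringHom_apply, Polynomial.coe_mul, Polynomial.coe_pow,
    Polynomial.coe_C, Polynomial.coe_sub, Polynomial.coe_one, Polynomial.coe_X, h9, ← h,
    PowerSeries.smul_eq_C_mul, Nat.add_sub_cancel_left]
  rw [mul_pow, pow_add]
  ring

/-- The point x = 1 lies over t = ∞, so only the top coefficient survives; the coefficient of x^(2M)
plays the same role at x = ∞. -/
theorem eval_one_levelSixPoly {R : Type*} [CommRing R] (M : ℕ) (U : R[X]) :
    (levelSixPoly M U).eval 1 = U.coeff M * (-8) ^ M := by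
  rw [levelSixPoly, Finset.sum_range_succ, eval_add, eval_finsetSum, Finset.sum_eq_zero, zero_add]
  · simp; norm_num
  · intro j hj
    have : M - j ≠ 0 := by have := Finset.mem_range.1 hj; omega
    simp [this]

theorem coeff_two_mul_levelSixPoly {R : Type*} [CommRing R] (M : ℕ) (U : R[X]) :
    (levelSixPoly M U).coeff (2 * M) = U.coeff M * (-9) ^ M := by
  have hu : (X * (1 - 9 * X) : R[X]).natDegree ≤ 2 := by compute_degree
  have hw : (1 - X : R[X]).natDegree ≤ 1 := by compute_degree
  rw [levelSixPoly, Finset.sum_range_succ, coeff_add, finsetSum_coeff, Finset.sum_eq_zero,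
    zero_add]
  · rw [Nat.sub_self, pow_zero, mul_one, coeff_C_mul, mul_comm 2 M, coeff_pow_of_natDegree_le hu]
    congr 2
    rw [show (X * (1 - 9 * X) : R[X]) = X + C (-9) * X ^ 2 by rw [C_neg, map_ofNat]; ring]
    simp [coeff_X]
  · intro j hj
    have hj := Finset.mem_range.1 hj
    rw [mul_assoc, coeff_C_mul]
    apply mul_eq_zero_of_right
    apply coeff_eq_zero_of_natDegree_lt
    calc _ ≤ j * 2 + (M - j) * 1 :=
          natDegree_mul_le_of_le (natDegree_pow_le_of_le j hu) (natDegree_pow_le_of_le _ hw)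
      _ < 2 * M := by omega

theorem natDegree_levelSixPoly_le {R : Type*} [CommRing R] (M : ℕ) (U : R[X]) :
    (levelSixPoly M U).natDegree ≤ 2 * M := by
  have hu : (X * (1 - 9 * X) : R[X]).natDegree ≤ 2 := by compute_degree
  have hw : (1 - X : R[X]).natDegree ≤ 1 := by compute_degree
  refine natDegree_sum_le_of_forall_le _ _ fun j hj => ?_
  have hj := Finset.mem_range.1 hj
  rw [mul_assoc]
  calc _ ≤ j * 2 + (M - j) * 1 := (natDegree_C_mul_le _ _).trans <|
          natDegree_mul_le_of_le (natDegree_pow_le_of_le j hu) (natDegree_pow_le_of_le _ hw)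
    _ ≤ 2 * M := by omega

/-- The point x = 1/9 lies over t = 0, so only the constant coefficient survives. -/
theorem eval_one_div_nine_levelSixPoly {K : Type*} [Field K] (h9 : (9 : K) ≠ 0) (M : ℕ) (U : K[X]) :
    (levelSixPoly M U).eval (1 / 9) = U.coeff 0 * (8 / 9) ^ M := by
  rw [levelSixPoly, Finset.sum_range_succ', eval_add, eval_finsetSum, Finset.sum_eq_zero, zero_add]
  · simp; left; congr 1; field_simp; norm_num
  · intro j hj
    simp [h9]

theorem natDegree_zagierPoly_le {p : ℕ} : (zagierPoly p).natDegree ≤ p - 1 := by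
  rw [natDegree_le_iff_coeff_eq_zero]
  intro n hn
  rw [zagierPoly, PowerSeries.coeff_trunc, if_neg (by omega)]

variable {p : ℕ} [Fact p.Prime]

theorem coeff_zagierPoly {n : ℕ} (hn : n < p) : (zagierPoly p).coeff n = zagierNumber n := by
  rw [zagierPoly, PowerSeries.coeff_trunc, if_pos hn]; simp [zagierSeries]

theorem coeff_aperyPoly {n : ℕ} (hn : n < p) : (aperyPoly p).coeff n = aperyNumber n := by
  rw [aperyPoly, PowerSeries.coeff_trunc, if_pos hn]; simp [aperySeries]

theorem sub_one_lt_of_prime : p - 1 < p := Nat.sub_lt (Fact.out : p.Prime).pos one_pos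

theorem coeff_zero_zagierPoly : (zagierPoly p).coeff 0 = 1 := by
  rw [coeff_zagierPoly (Fact.out : p.Prime).pos]; simp [zagierNumber]

theorem coeff_zero_aperyPoly : (aperyPoly p).coeff 0 = 1 := by
  rw [coeff_aperyPoly (Fact.out : p.Prime).pos]; simp [aperyNumber]

theorem natDegree_aperyPoly : (aperyPoly p).natDegree = p - 1 := by
  apply natDegree_eq_of_le_of_coeff_ne_zero
  · rw [natDegree_le_iff_coeff_eq_zero]
    intro n hn
    rw [aperyPoly, PowerSeries.coeff_trunc, if_neg (by omega)]
  · rw [coeff_aperyPoly sub_one_lt_of_prime, cast_aperyNumber_sub_one]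
    exact one_ne_zero

theorem eval_one_zagierPoly (hp : p ≠ 2) : (zagierPoly p).eval 1 = 1 := by
  rw [eval_eq_sum_range' (natDegree_zagierPoly_le.trans_lt sub_one_lt_of_prime)]
  refine Eq.trans ?_ (sum_cast_zagierNumber hp)
  refine Finset.sum_congr rfl fun n hn => ?_
  rw [coeff_zagierPoly (Finset.mem_range.1 hn)]; simp

theorem coeff_sub_one_zagierPoly (hp : p ≠ 2) :
    (zagierPoly p).coeff (p - 1) = (-3) ^ (p / 2) := by
  rw [coeff_zagierPoly sub_one_lt_of_prime, cast_zagierNumber_sub_one hp]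

theorem zagierPoly_sq_eq_levelSixPoly :
    zagierPoly p ^ 2 = levelSixPoly (p - 1) (aperyPoly p) := by
  apply Polynomial.coe_injective
  rw [coe_levelSixPoly natDegree_aperyPoly.le, ← zagierPoly_sq, Polynomial.coe_pow]

theorem zmod_ofNat_ne_zero (hp : 3 < p) (n : ℕ) (a b : ℕ) (h : n = 2 ^ a * 3 ^ b) :
    (n : ZMod p) ≠ 0 := by
  rw [h]
  push_cast
  refine mul_ne_zero (pow_ne_zero _ ?_) (pow_ne_zero _ ?_)
  · exact_mod_cast natCast_zmod_ne_zero (p := p) (n := 2) (by omega) (by omega)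
  · exact_mod_cast natCast_zmod_ne_zero (p := p) (n := 3) (by omega) (by omega)

theorem eval_zagierPoly_ne_zero (hp : 3 < p) : (zagierPoly p).eval (1 / 9) ≠ 0 := by
  have h9 : (9 : ZMod p) ≠ 0 := by exact_mod_cast zmod_ofNat_ne_zero hp 9 0 2 rfl
  have h8 : (8 : ZMod p) ≠ 0 := by exact_mod_cast zmod_ofNat_ne_zero hp 8 3 0 rfl
  intro h
  have h2 := congrArg (eval (1 / 9)) (zagierPoly_sq_eq_levelSixPoly (p := p))
  rw [eval_one_div_nine_levelSixPoly h9, eval_pow, h, coeff_zero_aperyPoly, one_mul,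
    zero_pow two_ne_zero] at h2
  exact pow_ne_zero _ (div_ne_zero h8 h9) h2.symm

theorem map_eulerDerivation {R S : Type*} [CommRing R] [CommRing S] (h : R →+* S) (f : R⟦X⟧) :
    (eulerDerivation R f).map h = eulerDerivation S (f.map h) := by
  ext n; simp [coeff_eulerDerivation]

theorem coe_eulerDerivation {R : Type*} [CommRing R] (f : R[X]) :
    eulerDerivation R (f : R⟦X⟧) = ((X * derivative f : R[X]) : R⟦X⟧) := by
  rw [eulerDerivation_apply, PowerSeries.derivative_coe]; simp

theorem zagierSeries_equation :
    (1 - PowerSeries.X) * (1 - 9 * PowerSeries.X) *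
      eulerDerivation (ZMod p) (eulerDerivation (ZMod p) (zagierSeries p)) =
    (10 * PowerSeries.X - 18 * PowerSeries.X ^ 2) * eulerDerivation (ZMod p) (zagierSeries p) +
      (3 * PowerSeries.X - 9 * PowerSeries.X ^ 2) * zagierSeries p := by
  have h := congrArg (PowerSeries.map (Int.castRingHom (ZMod p))) zagierGenSeries_equation
  simp only [map_mul, map_sub, map_add, map_one, map_pow, map_ofNat, PowerSeries.map_X,
    map_eulerDerivation, ← zagierSeries_eq_map] at h
  exact h

/-- In F = H F^p the factor F^p is a constant for the derivation and cancels from the equation of F.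
-/
theorem zagierPoly_equation :
    (1 - X) * (1 - 9 * X) * (X * derivative (X * derivative (zagierPoly p))) =
      (10 * X - 18 * X ^ 2) * (X * derivative (zagierPoly p)) +
        (3 * X - 9 * X ^ 2) * zagierPoly p := by
  have h := zagierSeries_equation (p := p)
  have hp0 : eulerDerivation (ZMod p) (zagierSeries p ^ p) = 0 := by
    rw [Derivation.leibniz_pow, ← Nat.cast_smul_eq_nsmul (ZMod p), ZMod.natCast_self, zero_smul]
  have hne := pow_ne_zero p (zagierSeries_ne_zero (p := p))
  have h2 := zagierSeries_eq_mul_pow (p := p)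
  set u := zagierSeries p ^ p
  rw [h2] at h
  simp only [eulerDerivation_mul, hp0, mul_zero, zero_add, coe_eulerDerivation] at h
  apply Polynomial.coe_injective
  apply mul_right_cancel₀ hne
  have e (n : ℕ) [n.AtLeastTwo] : ((ofNat(n) : (ZMod p)[X]) : (ZMod p)⟦X⟧) = ofNat(n) :=
    map_ofNat Polynomial.coeToPowerSeries.ringHom n
  simp only [Polynomial.coe_mul, Polynomial.coe_add, Polynomial.coe_sub, Polynomial.coe_one,
    Polynomial.coe_pow, Polynomial.coe_X, e] at h ⊢
  linear_combination h

end Polynomials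

/-! ### Squarefreeness of H. -/

section Squarefree

open Polynomial

variable {p : ℕ} [Fact p.Prime]

theorem zagierPoly_ne_zero : zagierPoly p ≠ 0 := fun h => by
  have := coeff_zero_zagierPoly (p := p)
  simp [h] at this

/-- No irreducible polynomial divides `zagierPoly p` twice. -/
theorem not_sq_dvd_zagierPoly (hp : 3 < p) {q : (ZMod p)[X]} (hq : Irreducible q) :
    ¬ q ^ 2 ∣ zagierPoly p := by
  intro hdvd
  have hH := zagierPoly_ne_zero (p := p)
  have hqp : Prime q := hq.prime
  obtain ⟨G, hG, hqG⟩ := (FiniteMultiplicity.of_prime_left hqp hH).exists_eq_pow_mul_and_not_dvd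
  have hm : 2 ≤ multiplicity q (zagierPoly p) :=
    (FiniteMultiplicity.of_prime_left hqp hH).le_multiplicity_of_pow_dvd hdvd
  obtain ⟨k, hk⟩ := Nat.exists_eq_add_of_le' hm
  rw [hk] at hG
  have hG0 : G ≠ 0 := fun h => hqG (h ▸ dvd_zero q)
  -- The multiplicity stays below p, so the factor (k + 1)(k + 2) from differentiating twice is
  -- nonzero modulo p.
  have hkp : k + 2 < p := by
    have h1 := congrArg natDegree hG
    rw [natDegree_mul (pow_ne_zero _ hq.ne_zero) hG0, natDegree_pow] at h1
    have h2 := natDegree_zagierPoly_le (p := p)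
    have h3 := hq.natDegree_pos
    have h4 : (k + 2) * 1 ≤ (k + 2) * q.natDegree := Nat.mul_le_mul_left _ h3
    omega
  have hODE := zagierPoly_equation (p := p)
  have hc : (C ((k + 1 : ℕ) : ZMod p)) * C ((k + 2 : ℕ) : ZMod p) ≠ 0 := by
    rw [← C_mul]
    exact C_ne_zero.2 (mul_ne_zero (natCast_zmod_ne_zero (by omega) (by omega))
      (natCast_zmod_ne_zero (by omega) hkp))
  have hcu : IsUnit (C ((k + 1 : ℕ) : ZMod p) * C ((k + 2 : ℕ) : ZMod p)) := by
    rw [← C_mul] at hc ⊢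
    exact isUnit_C.2 (IsUnit.mk0 _ (C_ne_zero.1 hc))
  rw [hG] at hODE
  simp only [derivative_mul, derivative_pow, derivative_X, Nat.cast_add, Nat.cast_ofNat,
    derivative_add, derivative_C] at hODE
  rw [show k + 2 - 1 = k + 1 from rfl, Nat.add_sub_cancel] at hODE
  -- Only the second derivative lowers the q-adic order to k; after division by q^k this leading
  -- term must be divisible by q.
  have hkey : q ∣ (1 - X) * (1 - 9 * X) * X ^ 2 *
      (C ((k + 1 : ℕ) : ZMod p) * C ((k + 2 : ℕ) : ZMod p)) * derivative q ^ 2 * G := by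
    have hqk := pow_ne_zero k hq.ne_zero
    push_cast at hODE ⊢
    refine ⟨-((1 - X) * (1 - 9 * X) * X * (C (k + 2 : ZMod p) * derivative q * G +
      q * derivative G) + (1 - X) * (1 - 9 * X) * X ^ 2 *
      (C (k + 2 : ZMod p) * derivative (derivative q) * G +
        2 * C (k + 2 : ZMod p) * derivative q * derivative G + q * derivative (derivative G)) -
      (10 * X - 18 * X ^ 2) * X * (C (k + 2 : ZMod p) * derivative q * G + q * derivative G) -
      (3 * X - 9 * X ^ 2) * q * G), mul_left_cancel₀ hqk ?_⟩
    linear_combination hODE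
  have hroot : ∀ (r : (ZMod p)[X]) (x : ZMod p), r.natDegree = 1 → r.eval x = 0 →
      (zagierPoly p).eval x ≠ 0 → ¬ q ∣ r := by
    intro r x hr hx hHx hqr
    have hr0 : Irreducible r := irreducible_of_degree_eq_one
      (by rw [degree_eq_natDegree (by rintro rfl; simp at hr), hr]; rfl)
    have h1 : r ∣ zagierPoly p :=
      (hq.associated_of_dvd hr0 hqr).symm.dvd.trans ((dvd_pow_self q two_ne_zero).trans hdvd)
    obtain ⟨s, hs⟩ := h1
    exact hHx (by rw [hs, eval_mul, hx, zero_mul])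
  have h9 : (9 : ZMod p) ≠ 0 := by exact_mod_cast zmod_ofNat_ne_zero hp 9 0 2 rfl
  rcases hqp.dvd_or_dvd hkey with h | h
  · rcases hqp.dvd_or_dvd h with h | h
    · rcases hqp.dvd_or_dvd h with h | h
      · rcases hqp.dvd_or_dvd h with h | h
        · rcases hqp.dvd_or_dvd h with h | h
          · refine hroot _ 1 ?_ (by simp) ?_ h
            · rw [show (1 - X : (ZMod p)[X]) = C (-1) * X + C 1 by
                rw [C_neg, C_1]; ring]
              exact natDegree_linear (by simp)
            · rw [eval_one_zagierPoly (by omega)]; exact one_ne_zero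
          · refine hroot _ (1 / 9) ?_ (by simp [h9]) (eval_zagierPoly_ne_zero hp) h
            rw [show (1 - 9 * X : (ZMod p)[X]) = C (-9) * X + C 1 by
              rw [C_neg, map_ofNat, C_1]; ring]
            exact natDegree_linear (by simpa using h9)
        · refine hroot X 0 natDegree_X (by simp) ?_ (hqp.dvd_of_dvd_pow h)
          rw [← coeff_zero_eq_eval_zero, coeff_zero_zagierPoly]; exact one_ne_zero
      · exact hq.not_isUnit (isUnit_of_dvd_unit h hcu)
    · have hsep : q.Separable := PerfectField.separable_of_irreducible hq
      exact hq.not_isUnit (hsep.isUnit_of_dvd' dvd_rfl (hqp.dvd_of_dvd_pow h))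
  · exact hqG h

/-- The square of `zagierPoly p` is not an `e`-th power for `e > 2`. -/
theorem le_two_of_zagierPoly_sq_eq_pow (hp : 3 < p) {e : ℕ} {Z : (ZMod p)[X]}
    (h : zagierPoly p ^ 2 = Z ^ e) : e ≤ 2 := by
  by_contra! he
  have hnu : ¬ IsUnit (zagierPoly p) := by
    intro hu
    have h1 := natDegree_eq_zero_of_isUnit hu
    have h2 := coeff_sub_one_zagierPoly (p := p) (by omega)
    rw [coeff_eq_zero_of_natDegree_lt (by omega)] at h2
    have h3 : (-3 : ZMod p) ≠ 0 := neg_ne_zero.2 (by exact_mod_cast zmod_ofNat_ne_zero hp 3 0 1 rfl)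
    exact pow_ne_zero _ h3 h2.symm
  obtain ⟨q, hq, hqH⟩ := WfDvdMonoid.exists_irreducible_factor hnu zagierPoly_ne_zero
  have hZ : q ∣ Z := hq.prime.dvd_of_dvd_pow (h ▸ dvd_pow hqH two_ne_zero)
  have h3 : q ^ 3 ∣ zagierPoly p ^ 2 := h ▸ (pow_dvd_pow q he).trans (pow_dvd_pow_of_dvd hZ e)
  obtain ⟨G, hG⟩ := hqH
  have hG' : q ∣ G ^ 2 := by
    rw [hG, mul_pow, pow_succ] at h3
    exact (mul_dvd_mul_iff_left (pow_ne_zero 2 hq.ne_zero)).1 h3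
  apply not_sq_dvd_zagierPoly hp hq
  rw [hG, sq]
  exact mul_dvd_mul_left q (hq.prime.dvd_of_dvd_pow hG')

/-- If the truncated Apéry series is an `e`-th power, then `e ≤ 2`. -/
theorem le_two_of_aperyPoly_eq_pow (hp : 3 < p) {e : ℕ} {R : (ZMod p)[X]}
    (h : aperyPoly p = R ^ e) : e ≤ 2 := by
  have hd : p - 1 = R.natDegree * e := by
    rw [← natDegree_aperyPoly, h, natDegree_pow, mul_comm]
  -- As e · deg R = p - 1, the e-th power of the numerator of R(t) is (1 - x)^(p-1) A(t) = H².
  apply le_two_of_zagierPoly_sq_eq_pow hp (Z := levelSixPoly R.natDegree R)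
  apply Polynomial.coe_injective
  rw [Polynomial.coe_pow, Polynomial.coe_pow, zagierPoly_sq, coe_levelSixPoly le_rfl, h, map_pow,
    mul_pow, ← pow_mul, hd]

end Squarefree

/-! ### The quadratic extension and the square class of A. -/

section QuadraticExtension

open Polynomial

variable {p : ℕ} [Fact p.Prime]

local notation "τ" => levelSixMap (ZMod p)

theorem aeval_levelSixMap_injective (hp : p ≠ 2) :
    Function.Injective (aeval (R := ZMod p) τ) := by
  rw [injective_iff_map_eq_zero]
  intro U hU
  have h1 := coe_levelSixPoly (le_refl U.natDegree)
  rw [hU, mul_zero, ← Polynomial.coe_zero, Polynomial.coe_inj] at h1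
  have h2 := eval_one_levelSixPoly U.natDegree U
  rw [h1, eval_zero] at h2
  have h8 : (-8 : ZMod p) ≠ 0 := by
    have h2 : (2 : ZMod p) ≠ 0 := by
      have := (Fact.out : p.Prime).two_le
      exact_mod_cast natCast_zmod_ne_zero (p := p) (n := 2) (by omega) (by omega)
    rw [show (-8 : ZMod p) = -2 ^ 3 by norm_num]
    exact neg_ne_zero.2 (pow_ne_zero _ h2)
  exact leadingCoeff_eq_zero.1 ((mul_eq_zero.1 h2.symm).resolve_right (pow_ne_zero _ h8))

/-- The polynomial whose roots are the singular points of the Apéry differential equation. -/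
noncomputable def aperyDisc (R : Type*) [CommRing R] : R[X] := X ^ 2 - 34 * X + 1

theorem natDegree_aperyDisc (R : Type*) [CommRing R] [Nontrivial R] :
    (aperyDisc R).natDegree = 2 := by
  rw [aperyDisc]; compute_degree!

theorem aperyDisc_ne_sq (hp : 3 < p) (c : (ZMod p)[X]) : c ^ 2 ≠ aperyDisc (ZMod p) := by
  intro h
  have hd : c.natDegree ≤ 1 := by
    have := congrArg natDegree h
    rw [natDegree_pow, natDegree_aperyDisc] at this
    omega
  rw [eq_X_add_C_of_natDegree_le_one hd] at h
  set a := c.coeff 1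
  set b := c.coeff 0
  have e0 := congrArg (coeff · 0) h
  have e1 := congrArg (coeff · 1) h
  have e2 := congrArg (coeff · 2) h
  have hl : (C a * X + C b) ^ 2 = C (a ^ 2) * X ^ 2 + C (2 * a * b) * X + C (b ^ 2) := by
    simp only [C_mul, C_pow, map_ofNat]; ring
  have hr : aperyDisc (ZMod p) = C 1 * X ^ 2 + C (-34) * X + C 1 := by
    rw [aperyDisc, C_1, C_neg, map_ofNat]; ring
  rw [hl, hr] at e0 e1 e2
  simp only [coeff_add, coeff_C_mul, coeff_X_pow, coeff_X, coeff_C] at e0 e1 e2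
  norm_num at e0 e1 e2
  -- 1152 = 34² - 4 = 2⁷ · 3² is the discriminant of t² - 34t + 1.
  have h0 : ((1152 : ℕ) : ZMod p) = 0 := by
    push_cast
    rcases e0 with e0 | e0 <;> rcases e2 with e2 | e2 <;> rw [e0, e2] at e1 <;>
      first | linear_combination 32 * e1 | linear_combination -32 * e1 |
        linear_combination 36 * e1
  exact zmod_ofNat_ne_zero hp 1152 7 2 rfl h0

/-- The square root of the discriminant that generates `𝔽_p(x)` over `𝔽_p(t)`, where
`t = x (1 - 9 x) / (1 - x)`. -/
noncomputable def discRoot (R : Type*) [CommRing R] : R⟦X⟧ :=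
  18 * PowerSeries.X - 1 - levelSixMap R

/-- The quadratic equation of x over t; completing the square makes 18x - (1 + t) a root of (1 + t)²
- 36t = t² - 34t + 1. -/
theorem nine_mul_X_sq (R : Type*) [CommRing R] :
    (9 * PowerSeries.X ^ 2 : R⟦X⟧) = (1 + levelSixMap R) * PowerSeries.X - levelSixMap R := by
  linear_combination one_sub_mul_levelSixMap R

theorem discRoot_sq (R : Type*) [CommRing R] :
    discRoot R ^ 2 = aeval (levelSixMap R) (aperyDisc R) := by
  have h := nine_mul_X_sq R
  simp only [discRoot, aperyDisc, map_add, map_sub, map_mul, map_pow, aeval_X, map_one, map_ofNat]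
  linear_combination 36 * h

theorem eq_zero_of_add_mul_discRoot (hp : 3 < p) {U V : (ZMod p)[X]}
    (h : aeval τ U + aeval τ V * discRoot (ZMod p) = 0) : U = 0 ∧ V = 0 := by
  have hinj := aeval_levelSixMap_injective (p := p) (by omega)
  have h1 : U ^ 2 = aperyDisc (ZMod p) * V ^ 2 := by
    apply hinj
    simp only [map_mul, map_pow, ← discRoot_sq]
    linear_combination (aeval τ U - aeval τ V * discRoot (ZMod p)) * h
  have hV : V = 0 := by
    by_contra hV
    obtain ⟨c, rfl⟩ : V ∣ U := (UniqueFactorizationMonoid.pow_dvd_pow_iff_dvd two_ne_zero).1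
      ⟨_, h1.trans (mul_comm _ _)⟩
    apply aperyDisc_ne_sq hp c
    apply mul_right_cancel₀ (pow_ne_zero 2 hV)
    linear_combination h1
  subst hV
  refine ⟨hinj ?_, rfl⟩
  simpa using h

variable (p) in
/-- The power series of the form `U(t) + V(t) √(t² - 34 t + 1)` form a subring. -/
noncomputable def quadraticSubalgebra : Subalgebra (ZMod p) (ZMod p)⟦X⟧ where
  carrier := {f | ∃ U V : (ZMod p)[X], f = aeval τ U + aeval τ V * discRoot (ZMod p)}
  mul_mem' := by
    rintro _ _ ⟨U, V, rfl⟩ ⟨U', V', rfl⟩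
    refine ⟨U * U' + aperyDisc _ * V * V', U * V' + V * U', ?_⟩
    simp only [map_add, map_mul, ← discRoot_sq]
    ring
  add_mem' := by
    rintro _ _ ⟨U, V, rfl⟩ ⟨U', V', rfl⟩
    refine ⟨U + U', V + V', ?_⟩
    simp only [map_add]
    ring
  algebraMap_mem' := fun r => ⟨C r, 0, by simp⟩

theorem X_mem_quadraticSubalgebra (hp : 3 < p) :
    (PowerSeries.X : (ZMod p)⟦X⟧) ∈ quadraticSubalgebra p := by
  have h18 : (18 : ZMod p) ≠ 0 := by exact_mod_cast zmod_ofNat_ne_zero hp 18 1 2 rfl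
  refine ⟨C (1 / 18) * (1 + X), C (1 / 18), ?_⟩
  have h : (PowerSeries.C (1 / 18) : (ZMod p)⟦X⟧) * 18 = 1 := by
    rw [← map_ofNat PowerSeries.C, ← map_mul, one_div, inv_mul_cancel₀ h18, map_one]
  simp only [map_mul, map_add, map_one, aeval_X, aeval_C, discRoot,
    ← PowerSeries.C_eq_algebraMap]
  linear_combination -PowerSeries.X * h

theorem coe_mem_quadraticSubalgebra (hp : 3 < p) (f : (ZMod p)[X]) :
    (f : (ZMod p)⟦X⟧) ∈ quadraticSubalgebra p := by
  rw [f.as_sum_range_C_mul_X_pow, ← Polynomial.coeToPowerSeries.ringHom_apply, map_sum]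
  refine sum_mem fun n _ => ?_
  simp only [Polynomial.coeToPowerSeries.ringHom_apply, Polynomial.coe_mul, Polynomial.coe_C,
    Polynomial.coe_pow, Polynomial.coe_X]
  exact mul_mem (algebraMap_mem (quadraticSubalgebra p) _)
    (pow_mem (X_mem_quadraticSubalgebra hp) _)

theorem mk_one_mem_quadraticSubalgebra (hp : 3 < p) :
    (PowerSeries.mk 1 : (ZMod p)⟦X⟧) ∈ quadraticSubalgebra p := by
  have h16 : (16 : ZMod p) ≠ 0 := by exact_mod_cast zmod_ofNat_ne_zero hp 16 4 0 rfl
  -- Inverse via the conjugate x' of x: (1 - x)(1 - x') = 8/9 and 18(1 - x') = 17 - t + `discRoot`.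
  refine ⟨C (1 / 16) * (17 - X), C (1 / 16), ?_⟩
  have h : (PowerSeries.C (1 / 16) : (ZMod p)⟦X⟧) * 16 = 1 := by
    rw [← map_ofNat PowerSeries.C, ← map_mul, one_div, inv_mul_cancel₀ h16, map_one]
  simp only [map_mul, map_sub, map_ofNat, aeval_X, aeval_C, discRoot,
    ← PowerSeries.C_eq_algebraMap]
  apply mul_right_cancel₀ (one_sub_X_ne_zero (p := p))
  rw [PowerSeries.mk_one_mul_one_sub_eq_one]
  linear_combination 2 * PowerSeries.C (1 / 16) * one_sub_mul_levelSixMap (ZMod p) - h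

/-- The truncated Apéry series is a square up to the factor `t² - 34 t + 1`. -/
theorem aperyPoly_eq_sq_or (hp : 3 < p) :
    (∃ U, aperyPoly p = U ^ 2) ∨ ∃ V, aperyPoly p = aperyDisc (ZMod p) * V ^ 2 := by
  have h2 : (2 : ZMod p) ≠ 0 := by exact_mod_cast zmod_ofNat_ne_zero hp 2 1 0 rfl
  have hodd := (Fact.out : p.Prime).eq_two_or_odd'.resolve_left (by omega)
  have hN : 2 * (p / 2) + 1 = p := Nat.two_mul_div_two_add_one_of_odd hodd
  have hH : (zagierPoly p : (ZMod p)⟦X⟧) ∈ quadraticSubalgebra p := coe_mem_quadraticSubalgebra hp _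
  -- H / (1 - x)^((p-1)/2) = U + V√D has square A(t), so the coefficient 2UV of √D vanishes.
  obtain ⟨U, V, hUV⟩ := mul_mem hH (pow_mem (mk_one_mem_quadraticSubalgebra hp) (p / 2))
  have hsq : (aeval τ U + aeval τ V * discRoot (ZMod p)) ^ 2 = aeval τ (aperyPoly p) := by
    have h := PowerSeries.mk_one_mul_one_sub_eq_one (ZMod p)
    rw [← hUV, mul_pow, zagierPoly_sq, show p - 1 = p / 2 * 2 by omega, ← pow_mul, mul_right_comm,
      ← mul_pow, mul_comm _ (PowerSeries.mk 1), h, one_pow, one_mul]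
  have h0 := eq_zero_of_add_mul_discRoot hp (U := U ^ 2 + aperyDisc _ * V ^ 2 - aperyPoly p)
    (V := C 2 * U * V) (by
      simp only [map_sub, map_add, map_mul, map_pow, ← discRoot_sq, ← hsq, map_ofNat]
      ring)
  rcases mul_eq_zero.1 h0.2 with h | h
  · have hU : U = 0 := (mul_eq_zero.1 h).resolve_left (C_ne_zero.2 h2)
    right
    refine ⟨V, ?_⟩
    have := h0.1
    rw [hU] at this
    linear_combination -this
  · left
    refine ⟨U, ?_⟩
    have := h0.1
    rw [h] at this
    linear_combination -this

/-- If the square of `zagierPoly p` is the square of a polynomial `Z` with prescribed value at `1`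
and leading coefficient, then these determine each other. -/
theorem zagierPoly_sign (hp : p ≠ 2) {Z : (ZMod p)[X]} (hZ : zagierPoly p ^ 2 = Z ^ 2) :
    Z.coeff (p - 1) = Z.eval 1 * (-3) ^ (p / 2) := by
  have h1 := eval_one_zagierPoly hp
  have h2 := coeff_sub_one_zagierPoly hp
  rcases sq_eq_sq_iff_eq_or_eq_neg.1 hZ with h | h
  · rw [← h, h1, h2, one_mul]
  · rw [h, eval_neg] at h1
    rw [h, coeff_neg] at h2
    linear_combination (-3) ^ (p / 2) * h1 - h2

theorem pow_half_mul_self_eq_one {a : ZMod p} (hp : p ≠ 2) (ha : a ≠ 0) :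
    a ^ (p / 2) * a ^ (p / 2) = 1 := by
  have hodd := (Fact.out : p.Prime).eq_two_or_odd'.resolve_left hp
  have hN : 2 * (p / 2) + 1 = p := Nat.two_mul_div_two_add_one_of_odd hodd
  rw [← pow_add, show p / 2 + p / 2 = p - 1 by omega]
  exact ZMod.pow_card_sub_one_eq_one ha

theorem pow_half_eq_of_eq (hp : 3 < p) {u ε : ZMod p} (hu : u ≠ 0)
    (h : u * (-9) ^ (p / 2) = ε * (u * (-8) ^ (p / 2)) * (-3) ^ (p / 2)) :
    ε * (-24) ^ (p / 2) = 1 := by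
  have h3 : (3 : ZMod p) ≠ 0 := by exact_mod_cast zmod_ofNat_ne_zero hp 3 0 1 rfl
  have e9 : (9 : ZMod p) ^ (p / 2) = 1 := by
    rw [show (9 : ZMod p) = 3 * 3 by norm_num, mul_pow]
    exact pow_half_mul_self_eq_one (by omega) h3
  have e1 : (-1 : ZMod p) ^ (p / 2) * (-1) ^ (p / 2) = 1 := by
    rw [← mul_pow]; norm_num
  have hh : (-9 : ZMod p) ^ (p / 2) = ε * ((-8) ^ (p / 2) * (-3) ^ (p / 2)) :=
    mul_left_cancel₀ hu (by linear_combination h)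
  rw [← mul_pow, show (-9 : ZMod p) = -1 * 9 by norm_num, mul_pow, e9, mul_one] at hh
  rw [show (-24 : ZMod p) = -1 * (-8 * -3) by norm_num, mul_pow]
  linear_combination e1 - (-1) ^ (p / 2) * hh

/-- Up to sign, H is the numerator of U(t), whose value at 1 and top coefficient are u(-8)^((p-1)/2)
and u(-9)^((p-1)/2). Their ratio must be that of H, namely (-3)^((p-1)/2). -/
theorem pow_half_of_aperyPoly_eq_sq (hp : 3 < p) {U : (ZMod p)[X]} (h : aperyPoly p = U ^ 2) :
    (-24 : ZMod p) ^ (p / 2) = 1 := by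
  have hodd := (Fact.out : p.Prime).eq_two_or_odd'.resolve_left (by omega)
  have hN : 2 * (p / 2) + 1 = p := Nat.two_mul_div_two_add_one_of_odd hodd
  have hd : U.natDegree = p / 2 := by
    have := natDegree_aperyPoly (p := p)
    rw [h, natDegree_pow] at this
    omega
  have hZ : zagierPoly p ^ 2 = levelSixPoly (p / 2) U ^ 2 := by
    apply Polynomial.coe_injective
    rw [Polynomial.coe_pow, Polynomial.coe_pow, zagierPoly_sq, coe_levelSixPoly hd.le, h, map_pow,
      mul_pow, ← pow_mul, show p / 2 * 2 = p - 1 by omega]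
  have hs := zagierPoly_sign (by omega) hZ
  rw [show p - 1 = 2 * (p / 2) by omega, coeff_two_mul_levelSixPoly, eval_one_levelSixPoly] at hs
  have hu : U.coeff (p / 2) ≠ 0 := by
    rw [← hd]
    refine leadingCoeff_ne_zero.2 ?_
    rintro rfl
    simp at hd
    omega
  have := pow_half_eq_of_eq hp (ε := 1) hu (by rw [one_mul]; exact hs)
  rwa [one_mul] at this

/-- The same comparison, but the factor 1 - 18x + 9x² has value -8 at 1 and top coefficient 9
instead of -9, which flips the sign. -/
theorem pow_half_of_aperyPoly_eq_disc_mul_sq (hp : 3 < p) {V : (ZMod p)[X]}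
    (h : aperyPoly p = aperyDisc (ZMod p) * V ^ 2) : (-24 : ZMod p) ^ (p / 2) = -1 := by
  have hodd := (Fact.out : p.Prime).eq_two_or_odd'.resolve_left (by omega)
  have hN : 2 * (p / 2) + 1 = p := Nat.two_mul_div_two_add_one_of_odd hodd
  have hV : V ≠ 0 := by
    rintro rfl
    have := coeff_zero_aperyPoly (p := p)
    simp [h] at this
  obtain ⟨M, hM⟩ : ∃ M, p / 2 = M + 1 := Nat.exists_eq_succ_of_ne_zero (by omega)
  have hd : V.natDegree = M := by
    have := natDegree_aperyPoly (p := p)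
    rw [h, natDegree_mul (by rintro h0; simpa [h0] using natDegree_aperyDisc (ZMod p))
      (pow_ne_zero _ hV), natDegree_pow, natDegree_aperyDisc] at this
    omega
  have hm : (((1 - 18 * X + 9 * X ^ 2 : (ZMod p)[X]) : (ZMod p)⟦X⟧)) ^ 2 =
      (1 - PowerSeries.X) ^ 2 * aeval τ (aperyDisc (ZMod p)) := by
    have e (n : ℕ) [n.AtLeastTwo] : ((ofNat(n) : (ZMod p)[X]) : (ZMod p)⟦X⟧) = ofNat(n) :=
      map_ofNat Polynomial.coeToPowerSeries.ringHom n
    have hT := one_sub_mul_levelSixMap (ZMod p)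
    rw [← discRoot_sq]
    simp only [Polynomial.coe_mul, Polynomial.coe_add, Polynomial.coe_sub, Polynomial.coe_one,
      Polynomial.coe_pow, Polynomial.coe_X, e, discRoot, ← mul_pow]
    rw [sq_eq_sq_iff_eq_or_eq_neg]
    right
    linear_combination -hT
  have hZ : zagierPoly p ^ 2 = ((1 - 18 * X + 9 * X ^ 2) * levelSixPoly M V) ^ 2 := by
    apply Polynomial.coe_injective
    rw [Polynomial.coe_pow, Polynomial.coe_pow, zagierPoly_sq, Polynomial.coe_mul,
      coe_levelSixPoly hd.le, h, map_mul, map_pow, mul_pow, hm, mul_pow, ← pow_mul,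
      show p - 1 = 2 + M * 2 by omega]
    ring
  have hs := zagierPoly_sign (by omega) hZ
  have hc : ((1 - 18 * X + 9 * X ^ 2) * levelSixPoly M V).coeff (p - 1) =
      9 * (V.coeff M * (-9) ^ M) := by
    rw [← coeff_two_mul_levelSixPoly, show p - 1 = 2 + 2 * M by omega,
      coeff_mul_add_eq_of_natDegree_le (by compute_degree) (natDegree_levelSixPoly_le M V)]
    congr 1
    rw [show (1 - 18 * X + 9 * X ^ 2 : (ZMod p)[X]) = C 1 + C (-18) * X + C 9 * X ^ 2 by
      rw [C_1, C_neg, map_ofNat, map_ofNat]; ring]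
    simp [coeff_one]
  rw [hc, eval_mul, eval_one_levelSixPoly] at hs
  have hu : V.coeff M ≠ 0 := by
    rw [← hd]
    exact leadingCoeff_ne_zero.2 hV
  have := pow_half_eq_of_eq hp (ε := -1) hu (by
    rw [hM] at hs ⊢
    simp only [eval_add, eval_sub, eval_mul, eval_pow, eval_X, eval_one, eval_ofNat] at hs
    linear_combination -hs)
  linear_combination -this

theorem aperyPoly_eq_sq_iff (hp : 3 < p) :
    (∃ U, aperyPoly p = U ^ 2) ↔ (-24 : ZMod p) ^ (p / 2) = 1 := by
  refine ⟨fun ⟨U, hU⟩ => pow_half_of_aperyPoly_eq_sq hp hU, fun h => ?_⟩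
  refine (aperyPoly_eq_sq_or hp).resolve_right fun ⟨V, hV⟩ => ?_
  rw [pow_half_of_aperyPoly_eq_disc_mul_sq hp hV] at h
  have h2 : (2 : ZMod p) ≠ 0 := by exact_mod_cast zmod_ofNat_ne_zero hp 2 1 0 rfl
  exact h2 (by linear_combination -h)

end QuadraticExtension

/-! ### Quadratic reciprocity modulo 24. -/

section Reciprocity

variable {p : ℕ} [Fact p.Prime]

/-- By Euler's criterion and -24 = 2² · (-6), this is the symbol of -6, which has period 4 · 6 in p.
-/
theorem neg_twentyFour_pow_half (hp : 3 < p) :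
    (-24 : ZMod p) ^ (p / 2) = (jacobiSym (-6) (p % 24) : ℤ) := by
  have h2 : (2 : ZMod p) ≠ 0 := by exact_mod_cast zmod_ofNat_ne_zero hp 2 1 0 rfl
  have hodd : Odd p := (Fact.out : p.Prime).eq_two_or_odd'.resolve_left (by omega)
  have h := jacobiSym.mod_right (-6) hodd
  norm_num at h
  rw [← h, ← jacobiSym.legendreSym.to_jacobiSym, legendreSym.eq_pow,
    show (-24 : ZMod p) = 2 * 2 * -6 by norm_num, mul_pow, mul_pow,
    pow_half_mul_self_eq_one (by omega) h2, one_mul]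
  push_cast
  rfl

theorem neg_twentyFour_pow_half_eq_one (hp : 3 < p)
    (h : p % 24 = 1 ∨ p % 24 = 5 ∨ p % 24 = 7 ∨ p % 24 = 11) : (-24 : ZMod p) ^ (p / 2) = 1 := by
  rw [neg_twentyFour_pow_half hp]
  rcases h with h | h | h | h <;> rw [h] <;> norm_num

theorem neg_twentyFour_pow_half_ne_one (hp : 3 < p)
    (h : p % 24 = 13 ∨ p % 24 = 17 ∨ p % 24 = 19 ∨ p % 24 = 23) :
    (-24 : ZMod p) ^ (p / 2) ≠ 1 := by
  have h2 : (2 : ZMod p) ≠ 0 := by exact_mod_cast zmod_ofNat_ne_zero hp 2 1 0 rfl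
  have h3 : (-24 : ZMod p) ^ (p / 2) = -1 := by
    rw [neg_twentyFour_pow_half hp]
    rcases h with h | h | h | h <;> rw [h] <;> norm_num
  rw [h3]
  intro h4
  exact h2 (by linear_combination -h4)

end Reciprocity

/-! ### Kummer theory of exponent p - 1. -/

section Kummer

open Polynomial

theorem exists_isPrimitiveRoot_zmod (p : ℕ) [Fact p.Prime] (K : Type*) [Field K]
    [Algebra (ZMod p) K] :
    ∃ ζ : ZMod p, IsPrimitiveRoot (algebraMap (ZMod p) K ζ) (p - 1) := by
  obtain ⟨g, hg⟩ := IsCyclic.exists_generator (α := (ZMod p)ˣ)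
  refine ⟨g, IsPrimitiveRoot.map_of_injective ?_ (algebraMap (ZMod p) K).injective⟩
  rw [IsPrimitiveRoot.coe_units_iff, ← ZMod.card_units p, ← Nat.card_eq_fintype_card,
    ← orderOf_eq_card_of_forall_mem_zpowers hg]
  exact IsPrimitiveRoot.orderOf g

variable {p : ℕ} [Fact p.Prime] {K L : Type*} [Field K] [Field L] [Algebra K L]
  [Algebra (ZMod p) K] {a : K} {γ : L}

theorem algebra_adjoin_eq_top_of_pow_eq {n : ℕ} (hn : n ≠ 0) (hγ : γ ^ n = algebraMap K L a)
    (htop : IntermediateField.adjoin K {γ} = ⊤) : Algebra.adjoin K {γ} = ⊤ := by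
  have hint : IsIntegral K γ := ⟨X ^ n - C a, monic_X_pow_sub_C a hn, by simp [hγ]⟩
  rw [← IntermediateField.adjoin_simple_toSubalgebra_of_isAlgebraic hint.isAlgebraic, htop,
    IntermediateField.top_toSubalgebra]

theorem isGalois_of_pow_sub_one_eq (ha : a ≠ 0) (hγ : γ ^ (p - 1) = algebraMap K L a)
    (htop : IntermediateField.adjoin K {γ} = ⊤) : FiniteDimensional K L ∧ IsGalois K L := by
  have hp0 : p - 1 ≠ 0 := by have := (Fact.out : p.Prime).two_le; omega
  have : CharP K p := charP_of_injective_algebraMap (algebraMap (ZMod p) K).injective p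
  obtain ⟨ζ, hζ⟩ := exists_isPrimitiveRoot_zmod p K
  have hζL := hζ.map_of_injective (algebraMap K L).injective
  have hmon := monic_X_pow_sub_C a hp0
  have hsplit : ((X ^ (p - 1) - C a : K[X]).map (algebraMap K L)).Splits := by
    rw [Polynomial.map_sub, Polynomial.map_pow, map_X, map_C]
    exact X_pow_sub_C_splits_of_isPrimitiveRoot hζL hγ
  have hsf : IsSplittingField K L (X ^ (p - 1) - C a) := by
    refine ⟨hsplit, ?_⟩
    rw [eq_top_iff, ← algebra_adjoin_eq_top_of_pow_eq hp0 hγ htop]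
    apply Algebra.adjoin_mono
    rw [Set.singleton_subset_iff, mem_rootSet_of_ne hmon.ne_zero]
    simp [hγ]
  have hn : ((p - 1 : ℕ) : K) ≠ 0 := by
    rw [Ne, CharP.cast_eq_zero_iff K p]
    intro h
    have := Nat.le_of_dvd (Nat.pos_of_ne_zero hp0) h
    have := (Fact.out : p.Prime).pos
    omega
  exact ⟨IsSplittingField.finiteDimensional L (X ^ (p - 1) - C a),
    IsGalois.of_separable_splitting_field (separable_X_pow_sub_C a hn ha)⟩

theorem exists_units_smul_eq (hγ0 : γ ≠ 0) (hγ : γ ^ (p - 1) = algebraMap K L a) (σ : L ≃ₐ[K] L) :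
    ∃ c : (ZMod p)ˣ, σ γ = algebraMap K L (algebraMap (ZMod p) K c) * γ := by
  have hp0 : p - 1 ≠ 0 := by have := (Fact.out : p.Prime).two_le; omega
  have : NeZero (p - 1) := ⟨hp0⟩
  obtain ⟨ζ, hζ⟩ := exists_isPrimitiveRoot_zmod p K
  have hζL := hζ.map_of_injective (algebraMap K L).injective
  have h1 : (σ γ / γ) ^ (p - 1) = 1 := by
    rw [div_pow, ← map_pow, hγ, AlgEquiv.commutes, ← hγ, div_self (pow_ne_zero _ hγ0)]
  obtain ⟨i, -, hi⟩ := hζL.eq_pow_of_pow_eq_one h1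
  have hζ0 : ζ ≠ 0 := by
    rintro rfl
    exact hζ.ne_zero hp0 (map_zero _)
  refine ⟨Units.mk0 ζ hζ0 ^ i, ?_⟩
  rw [Units.val_pow_eq_pow_val, Units.val_mk0, map_pow, map_pow, hi, div_mul_cancel₀ _ hγ0]

/-- The Kummer character of an extension generated by a `(p - 1)`-st root. -/
theorem exists_kummer_character (hγ0 : γ ≠ 0) (hγ : γ ^ (p - 1) = algebraMap K L a)
    (htop : IntermediateField.adjoin K {γ} = ⊤) :
    ∃ φ : (L ≃ₐ[K] L) →* (ZMod p)ˣ,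
      (∀ σ, σ γ = algebraMap K L (algebraMap (ZMod p) K (φ σ)) * γ) ∧ Function.Injective φ := by
  choose c hc using fun σ : L ≃ₐ[K] L => exists_units_smul_eq hγ0 hγ σ
  have huniq : ∀ u v : (ZMod p)ˣ, algebraMap K L (algebraMap (ZMod p) K u) * γ =
      algebraMap K L (algebraMap (ZMod p) K v) * γ → u = v := fun u v h =>
    Units.ext ((algebraMap (ZMod p) K).injective
      ((algebraMap K L).injective (mul_right_cancel₀ hγ0 h)))
  refine ⟨MonoidHom.mk' c fun σ τ => huniq _ _ ?_, hc, fun σ τ h => ?_⟩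
  · rw [← hc, AlgEquiv.mul_apply, hc τ, map_mul, AlgEquiv.commutes, hc σ, Units.val_mul, map_mul,
      map_mul]
    ring
  · have h' : c σ = c τ := h
    have hp0 : p - 1 ≠ 0 := by have := (Fact.out : p.Prime).two_le; omega
    have h1 : (σ : L →ₐ[K] L) = τ :=
      AlgHom.ext_of_adjoin_eq_top (algebra_adjoin_eq_top_of_pow_eq hp0 hγ htop) fun x hx => by
        rw [Set.mem_singleton_iff.1 hx]
        change σ γ = τ γ
        rw [hc, hc, h']
    exact AlgEquiv.ext fun x => DFunLike.congr_fun h1 x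

/-- Bounds the image of the character from above; `exists_eq_pow_card_range` is the converse, by
Galois descent. -/
theorem kummer_character_pow_eq_one (hγ0 : γ ≠ 0) {φ : (L ≃ₐ[K] L) →* (ZMod p)ˣ}
    (hφ : ∀ σ, σ γ = algebraMap K L (algebraMap (ZMod p) K (φ σ)) * γ) {m : ℕ} {g : K}
    (hg : γ ^ m = algebraMap K L g) (σ : L ≃ₐ[K] L) : φ σ ^ m = 1 := by
  have h : σ (γ ^ m) = γ ^ m := by rw [hg, AlgEquiv.commutes]
  rw [map_pow, hφ, mul_pow, ← map_pow, ← map_pow] at h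
  have h1 := mul_right_cancel₀ (pow_ne_zero m hγ0) (h.trans (one_mul _).symm)
  rw [← Units.val_pow_eq_pow_val] at h1
  apply Units.ext
  apply (algebraMap (ZMod p) K).injective
  apply (algebraMap K L).injective
  simpa using h1

theorem exists_eq_pow_card_range [FiniteDimensional K L] [IsGalois K L]
    {φ : (L ≃ₐ[K] L) →* (ZMod p)ˣ}
    (hφ : ∀ σ, σ γ = algebraMap K L (algebraMap (ZMod p) K (φ σ)) * γ) :
    ∃ g : K, algebraMap K L g = γ ^ Nat.card φ.range := by
  have h : γ ^ Nat.card φ.range ∈ (⊥ : IntermediateField K L) := by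
    rw [IsGalois.mem_bot_iff_fixed]
    intro σ
    have h1 : φ σ ^ Nat.card φ.range = 1 := by
      have := pow_card_eq_one' (x := (⟨φ σ, σ, rfl⟩ : φ.range))
      exact congrArg Subtype.val this
    rw [map_pow, hφ, mul_pow, ← map_pow, ← map_pow, ← Units.val_pow_eq_pow_val, h1]
    simp
  exact IntermediateField.mem_bot.1 h

end Kummer

/-! ### The field generated by the Apéry series. -/

section AperyField

open Polynomial

variable {p : ℕ} [Fact p.Prime]

theorem aperySeries_ne_zero : aperySeries p ≠ 0 := fun h => by
  have := congrArg (PowerSeries.coeff 0) h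
  simp [aperySeries, aperyNumber] at this

theorem aperyGen_ne_zero : aperyGen p ≠ 0 := fun h =>
  aperySeries_ne_zero (HahnSeries.ofPowerSeries_injective
    ((congrArg Subtype.val h).trans (map_zero (HahnSeries.ofPowerSeries ℤ (ZMod p))).symm))

theorem adjoin_aperyGen : IntermediateField.adjoin (RatFunc (ZMod p)) {aperyGen p} = ⊤ := by
  apply IntermediateField.lift_injective
  rw [IntermediateField.lift_adjoin_simple, IntermediateField.lift_top]
  rfl

theorem aperyPoly_ne_zero : aperyPoly p ≠ 0 := fun h => by
  have := coeff_zero_aperyPoly (p := p)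
  simp [h] at this

theorem aperyGen_pow_mul :
    algebraMap (RatFunc (ZMod p)) (aperyField p) (algebraMap _ _ (aperyPoly p)) *
      aperyGen p ^ (p - 1) = 1 := by
  apply Subtype.ext
  have h1 : ((algebraMap (RatFunc (ZMod p)) (aperyField p)
      (algebraMap (ZMod p)[X] _ (aperyPoly p)) : aperyField p) : (ZMod p)⸨X⸩) =
      HahnSeries.ofPowerSeries ℤ (ZMod p) (aperyPoly p) :=
    (IsScalarTower.algebraMap_apply (ZMod p)[X] (RatFunc (ZMod p)) (ZMod p)⸨X⸩ _).symm
  have h2 : (aperyPoly p : (ZMod p)⟦X⟧) * aperySeries p ^ (p - 1) = 1 := by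
    apply mul_right_cancel₀ (aperySeries_ne_zero (p := p))
    rw [mul_assoc, pow_sub_one_mul (Fact.out : p.Prime).ne_zero, one_mul]
    exact aperySeries_eq_mul_pow.symm
  rw [MulMemClass.coe_mul, h1, SubmonoidClass.coe_pow]
  change _ * HahnSeries.ofPowerSeries ℤ (ZMod p) (aperySeries p) ^ (p - 1) = 1
  rw [← map_pow, ← map_mul, h2, map_one]

theorem aperyGen_pow :
    aperyGen p ^ (p - 1) =
      algebraMap (RatFunc (ZMod p)) (aperyField p) (algebraMap _ _ (aperyPoly p))⁻¹ := by
  rw [map_inv₀]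
  exact eq_inv_of_mul_eq_one_right aperyGen_pow_mul

/-- If the truncated Apéry series is a square, then the `(p - 1) / 2`-th power of the Apéry series
is rational. -/
theorem exists_aperyGen_pow_half_eq (hp : p ≠ 2) {U : (ZMod p)[X]} (hU : aperyPoly p = U ^ 2) :
    ∃ g : RatFunc (ZMod p), aperyGen p ^ (p / 2) = algebraMap _ (aperyField p) g := by
  have hodd := (Fact.out : p.Prime).eq_two_or_odd'.resolve_left hp
  have hN : 2 * (p / 2) + 1 = p := Nat.two_mul_div_two_add_one_of_odd hodd
  have h := aperyGen_pow (p := p)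
  rw [show p - 1 = p / 2 * 2 by omega, pow_mul, hU, map_pow, ← inv_pow, map_pow] at h
  rcases sq_eq_sq_iff_eq_or_eq_neg.1 h with h | h
  · exact ⟨_, h⟩
  · exact ⟨_, h.trans (map_neg _ _).symm⟩

/-- If a power of the Apéry series is rational, then the truncated series is a power. -/
theorem exists_aperyPoly_eq_pow {d e : ℕ} (hde : d * e = p - 1) {g : RatFunc (ZMod p)}
    (hg : algebraMap _ (aperyField p) g = aperyGen p ^ d) :
    ∃ R : (ZMod p)[X], aperyPoly p = R ^ e := by
  have he : 0 < e := Nat.pos_of_ne_zero (by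
    rintro rfl
    have := (Fact.out : p.Prime).two_le
    omega)
  have h1 : (g⁻¹) ^ e = algebraMap (ZMod p)[X] (RatFunc (ZMod p)) (aperyPoly p) := by
    apply (algebraMap (RatFunc (ZMod p)) (aperyField p)).injective
    rw [inv_pow, map_inv₀, map_pow, hg, ← pow_mul, hde, aperyGen_pow, map_inv₀, inv_inv]
  -- A rational function with a polynomial power is itself a polynomial.
  obtain ⟨R, hR⟩ := IsIntegrallyClosed.exists_algebraMap_eq_of_isIntegral_pow (R := (ZMod p)[X]) he
    (h1 ▸ isIntegral_algebraMap)
  refine ⟨R, IsFractionRing.injective (ZMod p)[X] (RatFunc (ZMod p)) ?_⟩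
  rw [map_pow, hR, h1]

end AperyField

/-! ### The Galois group. -/

theorem theorem1 (p : ℕ) [Fact p.Prime] (hp : p ≠ 2) :
    IsGalois (RatFunc (ZMod p)) (aperyField p) ∧
    ∃ φ : (aperyField p ≃ₐ[RatFunc (ZMod p)] aperyField p) →* (ZMod p)ˣ,
      (∀ σ, σ (aperyGen p) / aperyGen p =
        algebraMap (RatFunc (ZMod p)) (aperyField p) (RatFunc.C (φ σ : ZMod p))) ∧
      Function.Injective φ ∧
      (p % 24 = 1 ∨ p % 24 = 5 ∨ p % 24 = 7 ∨ p % 24 = 11 →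
        φ.range = Subgroup.square (ZMod p)ˣ) ∧
      (p % 24 = 13 ∨ p % 24 = 17 ∨ p % 24 = 19 ∨ p % 24 = 23 →
        φ.range = ⊤) := by
  have hA : (algebraMap (Polynomial (ZMod p)) (RatFunc (ZMod p)) (aperyPoly p))⁻¹ ≠ 0 :=
    inv_ne_zero ((map_ne_zero_iff _ (IsFractionRing.injective (Polynomial (ZMod p)) _)).2
      aperyPoly_ne_zero)
  obtain ⟨_, hGal⟩ := isGalois_of_pow_sub_one_eq hA aperyGen_pow adjoin_aperyGen
  obtain ⟨φ, hφ, hinj⟩ := exists_kummer_character (p := p) (aperyGen_ne_zero (p := p)) aperyGen_pow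
    adjoin_aperyGen
  refine ⟨hGal, φ, fun σ => ?_, hinj, ?_⟩
  · rw [hφ, mul_div_cancel_right₀ _ aperyGen_ne_zero]
    rfl
  obtain ⟨g, hg⟩ := exists_eq_pow_card_range hφ
  have hcard : Nat.card φ.range * φ.range.index = p - 1 := by
    rw [Subgroup.card_mul_index, Nat.card_eq_fintype_card, ZMod.card_units]
  obtain ⟨R, hR⟩ := exists_aperyPoly_eq_pow hcard hg
  -- The prime 3 belongs to neither list of residues, so 3 < p holds in both cases below.
  have hindex (h3 : 3 < p) : φ.range.index = 1 ∨ φ.range.index = 2 := by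
    have h1 := le_two_of_aperyPoly_eq_pow h3 hR
    have h2 : φ.range.index ≠ 0 := Subgroup.index_ne_zero_of_finite
    omega
  constructor
  · intro h
    have h3 : 3 < p := by
      have := (Fact.out : p.Prime).two_le
      omega
    obtain ⟨U, hU⟩ := (aperyPoly_eq_sq_iff h3).2 (neg_twentyFour_pow_half_eq_one h3 h)
    apply le_antisymm
    · rintro _ ⟨σ, rfl⟩
      obtain ⟨g', hg'⟩ := exists_aperyGen_pow_half_eq hp hU
      obtain ⟨y, hy⟩ := (ZMod.euler_criterion_units p (φ σ)).2
        (kummer_character_pow_eq_one aperyGen_ne_zero hφ hg' σ)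
      exact ⟨y, by rw [← hy, sq]⟩
    · rintro _ ⟨x, rfl⟩
      rcases hindex h3 with h | h
      · rw [Subgroup.index_eq_one.1 h]; trivial
      · rw [← sq]; exact Subgroup.sq_mem_of_index_two h x
  · intro h
    have h3 : 3 < p := by
      have := (Fact.out : p.Prime).two_le
      omega
    rcases hindex h3 with h' | h'
    · exact Subgroup.index_eq_one.1 h'
    · exact absurd ((aperyPoly_eq_sq_iff h3).1 ⟨R, h' ▸ hR⟩) (neg_twentyFour_pow_half_ne_one h3 h)
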